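/- Let $m,n,s,k,\lambda,t$ be positive integers such that $\lambda\mid 2nk$ and $t\mid \frac{2nk}{\lambda}$, put $v=\frac{2nk}{\lambda}+t$, and let $J$ be the subgroup of $\mathbb{Z}_v$ of order $t$. Let $A=(a_b)$ be a $\lambda$-fold Heffter array ${}^\lambda\mathrm{H}_t(m,n;s,k)$ over $\mathbb{Z}_v$ relative to $J$, that is, an $m\times n$ array with entries in $\mathbb{Z}_v$, some cells of which may be empty, such that each row has $s$ and each column has $k$ filled cells, the multiset $\{\pm x\mid x\in A\}$ contains each element of $\mathbb{Z}_v\setminus J$ exactly $\lambda$ times, and the elements of every row and of every column sum to $0$ in $\mathbb{Z}_v$. Let $\mathrm{skel}(A)$ be the set of filled cells. Let $\alpha_r$ be a permutation of $\mathrm{skel}(A)$ that acts on the filled cells of each row as a single cycle, and $\alpha_c$ one that acts on the filled cells of each column as a single cycle. Choosing a first cell $b$ in each row (column), $\alpha=\alpha_r$ ($\alpha=\alpha_c$) lists the entries of that row (column) as $(a_b,a_{\alpha(b)},a_{\alpha^2(b)},\dots)$; denote by $\omega_r$ and $\omega_c$ the resulting orderings of the rows and of the columns, and by $\omega_r^{-1}$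 the ordering that lists each row backwards. Assume that $\omega_r$ and $\omega_c$ are simple, i.e. for each row the partial sums $s_1,\dots,s_s$ of its list are pairwise distinct, and for each column the partial sums $s_1,\dots,s_k$ of its list are pairwise distinct, and that they are compatible, i.e. $\alpha_c\circ\alpha_r$ is a cycle of length $|\mathrm{skel}(A)|$. For such an ordering $\omega$ of the lines (rows or columns) of $A$, of length $\ell$, let $\mathcal{D}_\omega$ be the family of the $\ell$-cycles $(s_1+g,s_2+g,\dots,s_\ell+g)$ on the vertex set $\mathbb{Z}_v$, one for each line and each $g\in\mathbb{Z}_v$, where $s_1,\dots,s_\ell$ are the partial sums of that line. Let ${}^\lambda K$ be the multigraph obtained by repeating $\lambda$ times each edge of the complete multipartite graph on $\mathbb{Z}_v$ whose parts are the cosets of $J$. Then ${}^\lambda K$ is a ${}^\lambda K_{(\frac{2nk}{\lambda t}+1)\times t}$, that is, it has $\frac{2nk}{\lambda t}+1$ parts, each of size $t$; and, for a suitable choice of which of the parallel edges each cycle uses, $\mathcal{D}_{\omega_r^{-1}}$ and $\mathcal{D}_{\omega_c}$ are cycle decompositions of ${}^\lambda K$ (the edge sets of the cycles partition the edge set of ${}^\lambda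 K$; a $2$-cycle consists of two parallel edges), and there is a cellular biembedding of them into an orientable surface: there are a compact connected orientable surface $\Sigma$ without boundary and a continuous injective map $\psi:{}^\lambda K\to\Sigma$ from the topological multigraph such that every face (connected component of $\Sigma\setminus\psi({}^\lambda K)$) is homeomorphic to an open disc, and the faces can be coloured with two colours so that distinct faces whose boundaries share an edge have different colours, the faces of one colour correspond bijectively to the cycles of $\mathcal{D}_{\omega_r^{-1}}$ and those of the other colour to the cycles of $\mathcal{D}_{\omega_c}$, and the boundary of each face is the image under $\psi$ of the corresponding cycle. -/

import Mathlib

namespace HeffterBiembedding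

/-! ### Partially filled arrays and `λ`-fold relative Heffter arrays -/

/-- An `m × n` partially filled array with elements in `G`; `none` is an empty cell. -/
abbrev PFArray (m n : ℕ) (G : Type) := Matrix (Fin m) (Fin n) (Option G)

namespace PFArray

variable {m n : ℕ} {G : Type}

/-- The skeleton of `A`: the set of its filled cells. -/
abbrev Skel (A : PFArray m n G) : Type := {p : Fin m × Fin n // (A p.1 p.2).isSome = true}

/-- The element of `A` in a filled cell. -/
def entry (A : PFArray m n G) (b : A.Skel) : G := (A b.1.1 b.1.2).get b.2

/-- The row of a filled cell. -/
def row (A : PFArray m n G) (b : A.Skel) : Fin m := b.1.1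

/-- The column of a filled cell. -/
def col (A : PFArray m n G) (b : A.Skel) : Fin n := b.1.2

end PFArray

/-- `A` is a `λ`-fold Heffter array over `ℤ_v` relative to the subgroup `J` of order `t`, with
`v = 2nk/λ + t`, with `s` filled cells in each row and `k` filled cells in each column. -/
structure IsHeffterArray {m n v : ℕ} (lam t s k : ℕ) (J : AddSubgroup (ZMod v))
    (A : PFArray m n (ZMod v)) : Prop where
  lam_dvd : lam ∣ 2 * n * k
  t_dvd : t ∣ 2 * n * k / lam
  v_eq : v = 2 * n * k / lam + t
  card_J : Nat.card J = t
  row_filled : ∀ i, Fintype.card {b : A.Skel // A.row b = i} = s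
  col_filled : ∀ j, Fintype.card {b : A.Skel // A.col b = j} = k
  /-- the multiset `{±x ∣ x ∈ A}` contains `λ` times each element outside `J` -/
  count_eq : ∀ x : ZMod v, x ∉ J →
    ((Finset.univ : Finset A.Skel).val.map A.entry +
      (Finset.univ : Finset A.Skel).val.map (fun b => -A.entry b)).count x = lam
  row_sum : ∀ i, ∑ b : {b : A.Skel // A.row b = i}, A.entry b.1 = 0
  col_sum : ∀ j, ∑ b : {b : A.Skel // A.col b = j}, A.entry b.1 = 0

/-! ### Orderings of the lines of an array -/

/-- An ordering of each of the lines (rows, or columns) of a set `B` of cells, `line b` being the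
line of the cell `b`. It is given by a permutation of `B` that acts on each line as a cyclic
permutation (the successor of a cell in its line), and by the cell where each line begins. -/
structure LineOrdering {B ι : Type} (line : B → ι) where
  perm : Equiv.Perm B
  isCycleOn : ∀ i, perm.IsCycleOn {b | line b = i}
  start : ι → B
  line_start : ∀ i, line (start i) = i

namespace LineOrdering

variable {B ι G : Type} {line : B → ι} [AddCommGroup G]

/-- The reverse ordering: line `i`, listed as `b, α b, …, α⁻¹ b`, becomes `α⁻¹ b, …, α b, b`. -/
def inv (ω : LineOrdering line) : LineOrdering line where
  perm := ω.perm⁻¹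
  isCycleOn i := (ω.isCycleOn i).inv
  start i := ω.perm⁻¹ (ω.start i)
  line_start i := by
    have h := (ω.isCycleOn i).inv.1.mapsTo (show ω.start i ∈ {b | line b = i} from ω.line_start i)
    exact h

/-- The `j`-th partial sum of the ordered list `a (b), a (α b), a (α² b), …` of line `i`. -/
def partialSum (ω : LineOrdering line) (a : B → G) (i : ι) (j : ℕ) : G :=
  ∑ l ∈ Finset.range j, a ((ω.perm ^ l) (ω.start i))

/-- The ordering is simple: on every line, of length `ℓ`, the partial sums `s₁, …, s_ℓ` are
pairwise distinct. -/
def IsSimple (ω : LineOrdering line) (a : B → G) (ℓ : ℕ) : Prop :=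
  ∀ i, Set.InjOn (ω.partialSum a i) (Set.Icc 1 ℓ)

/-- The cycles of the decomposition `D_ω`, as cyclic sequences of vertices: they are indexed by
the lines `i` and the elements `g` of the group, and the cycle with index `(i, g)` is the
translate `(s₁ + g, …, s_ℓ + g)` of the sequence of partial sums of line `i`. -/
def cycleVertices (ω : LineOrdering line) (a : B → G) (ℓ : ℕ) (p : ι × G) (j : Fin ℓ) : G :=
  ω.partialSum a p.1 (j + 1) + p.2

end LineOrdering

/-- Row and column orderings are compatible if `α_c ∘ α_r` is a cycle of length `|skel A|`. -/
def Compatible {m n : ℕ} {G : Type} {A : PFArray m n G} (ωr : LineOrdering A.row)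
    (ωc : LineOrdering A.col) : Prop :=
  (ωc.perm * ωr.perm).IsCycle ∧ (ωc.perm * ωr.perm).support.card = Fintype.card A.Skel

/-! ### Multigraphs `^λΓ`, their cycles and their topology -/

/-- The complete multipartite graph on the group `G` whose parts are the cosets of `J`. -/
def cosetGraph {G : Type} [AddCommGroup G] (J : AddSubgroup G) : SimpleGraph G where
  Adj x y := x - y ∉ J
  symm := ⟨fun x y h h' => h (by simpa using J.neg_mem h')⟩
  loopless := ⟨fun x h => h (by simp)⟩

section Multigraph

variable {V : Type}

/-- The directed edges of the multigraph `^λΓ` obtained by repeating each edge of `Γ` `λ` times.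
The undirected edge underlying `d` is `(d.1.edge, d.2)`. -/
abbrev MultiDart (Γ : SimpleGraph V) (lam : ℕ) : Type := Γ.Dart × Fin lam

/-- A cycle of length `ℓ` in `^λΓ`, traversed in one direction from one of its vertices. For
`ℓ = 2` it consists of two parallel edges. -/
structure MultiCycle (Γ : SimpleGraph V) (lam ℓ : ℕ) where
  two_le : 2 ≤ ℓ
  dart : Fin ℓ → MultiDart Γ lam
  closed : ∀ j, (dart j).1.snd = (dart (finRotate ℓ j)).1.fst
  vertex_injective : Function.Injective fun j => (dart j).1.fst
  edge_injective : Function.Injective fun j => ((dart j).1.edge, (dart j).2)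

/-- The vertices of a cycle, in cyclic order. -/
def MultiCycle.vertex {Γ : SimpleGraph V} {lam ℓ : ℕ} (C : MultiCycle Γ lam ℓ) (j : Fin ℓ) : V :=
  (C.dart j).1.fst

/-- A family of `ℓ`-cycles of `^λΓ` whose edge-sets partition the edge-set of `^λΓ`. -/
def IsCycleDecomposition {Γ : SimpleGraph V} {lam ℓ : ℕ} {I : Type}
    (D : I → MultiCycle Γ lam ℓ) : Prop :=
  ∀ e ∈ Γ.edgeSet, ∀ c : Fin lam,
    ∃! p : I × Fin ℓ, (((D p.1).dart p.2).1.edge, ((D p.1).dart p.2).2) = (e, c)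

/-- The gluing that produces the topological multigraph `^λΓ` from isolated points, one for each
vertex, and unit intervals, one for each directed edge: the interval of `d` begins at the first
vertex of `d`, and opposite directed edges carry the same segment, run in opposite directions. -/
inductive Glue (Γ : SimpleGraph V) (lam : ℕ) :
    (Σ _ : V, Unit) ⊕ (Σ _ : MultiDart Γ lam, unitInterval) →
      (Σ _ : V, Unit) ⊕ (Σ _ : MultiDart Γ lam, unitInterval) → Prop
  | source (d : MultiDart Γ lam) : Glue Γ lam (Sum.inr ⟨d, 0⟩) (Sum.inl ⟨d.1.fst, ()⟩)
  | flip (d : MultiDart Γ lam) (r : unitInterval) :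
      Glue Γ lam (Sum.inr ⟨d, r⟩) (Sum.inr ⟨(d.1.symm, d.2), unitInterval.symm r⟩)

/-- The multigraph `^λΓ` as a topological space. -/
def Realization (Γ : SimpleGraph V) (lam : ℕ) : Type := Quot (Glue Γ lam)

instance (Γ : SimpleGraph V) (lam : ℕ) : TopologicalSpace (Realization Γ lam) :=
  inferInstanceAs (TopologicalSpace (Quot (Glue Γ lam)))

/-- The closed segment of an edge in the topological multigraph. -/
def edgeArc {Γ : SimpleGraph V} {lam : ℕ} (d : MultiDart Γ lam) : Set (Realization Γ lam) :=
  Set.range fun r : unitInterval => Quot.mk (Glue Γ lam) (Sum.inr ⟨d, r⟩)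

/-- The closed curve formed by the edges of a cycle in the topological multigraph. -/
def MultiCycle.carrier {Γ : SimpleGraph V} {lam ℓ : ℕ} (C : MultiCycle Γ lam ℓ) :
    Set (Realization Γ lam) :=
  ⋃ j, edgeArc (C.dart j)

end Multigraph

/-! ### Surfaces and embeddings -/

open scoped ContDiff in
/-- `S` is an orientable (closed, connected) surface: it is compact, connected and Hausdorff, and
has an atlas of charts in the plane `ℂ = ℝ²` whose transition maps are smooth with positive
Jacobian determinant. -/
structure IsOrientableSurface (S : Type) [TopologicalSpace S] : Prop where
  t2 : T2Space S
  compact : CompactSpace S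
  connected : ConnectedSpace S
  exists_oriented_atlas : ∃ atl : Set (OpenPartialHomeomorph S ℂ),
    (∀ p : S, ∃ e ∈ atl, p ∈ e.source) ∧
    ∀ e ∈ atl, ∀ e' ∈ atl,
      ContDiffOn ℝ ∞ (e.symm.trans e') (e.symm.trans e').source ∧
      ∀ z ∈ (e.symm.trans e').source, 0 < (fderiv ℝ (e.symm.trans e') z).det

section Embedding

variable {V S : Type} [TopologicalSpace S] {Γ : SimpleGraph V} {lam : ℕ}

/-- An embedding of the multigraph `^λΓ` in `S`. -/
def IsGraphEmbedding (ψ : Realization Γ lam → S) : Prop :=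
  Continuous ψ ∧ Function.Injective ψ

/-- The faces of an embedding: the connected components of the complement of its image. -/
def IsFace (ψ : Realization Γ lam → S) (F : Set S) : Prop :=
  ∃ x ∈ (Set.range ψ)ᶜ, F = connectedComponentIn (Set.range ψ)ᶜ x

/-- Each face is homeomorphic to an open disc. -/
def IsCellular (ψ : Realization Γ lam → S) : Prop :=
  ∀ F, IsFace ψ F → Nonempty (F ≃ₜ Metric.ball (0 : ℂ) 1)

/-- `ψ` is a biembedding of two cycle decompositions `D` and `D'` of `^λΓ`: an embedding whose
faces can be coloured with two colours, distinct faces whose boundaries share an edge having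
different colours, in such a way that the faces of one colour are bounded by the cycles of `D`
and those of the other colour by the cycles of `D'`, each cycle bounding one face. -/
def IsBiembedding {ℓ ℓ' : ℕ} {I I' : Type} (ψ : Realization Γ lam → S)
    (D : I → MultiCycle Γ lam ℓ) (D' : I' → MultiCycle Γ lam ℓ') : Prop :=
  IsCycleDecomposition D ∧ IsCycleDecomposition D' ∧ IsGraphEmbedding ψ ∧
  ∃ color : Set S → Bool,
    (∀ F F', IsFace ψ F → IsFace ψ F' → F ≠ F' → ∀ d : MultiDart Γ lam,
      ψ '' edgeArc d ⊆ frontier F → ψ '' edgeArc d ⊆ frontier F' → color F ≠ color F') ∧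
    (∃ f : I → Set S, Set.BijOn f Set.univ {F | IsFace ψ F ∧ color F = true} ∧
      ∀ i, frontier (f i) = ψ '' (D i).carrier) ∧
    (∃ f : I' → Set S, Set.BijOn f Set.univ {F | IsFace ψ F ∧ color F = false} ∧
      ∀ i, frontier (f i) = ψ '' (D' i).carrier)

end Embedding

end HeffterBiembedding

/-!
The entries `±a_b` cover each difference outside `J` exactly `λ` times, so the copies of the edges
of `^λK` can be matched with the pairs `(b, x)` of a cell and an element of `ℤ_v`, the pair `(b, x)`
standing for an edge from `x` to `x + a_b`. Passing to the next edge of a backward row cycle and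
passing to the next edge of a column cycle are two permutations of these pairs, and the second one
composed with the inverse of the first fixes `x` and moves `b` by `α_c ∘ α_r`. Compatibility
therefore says that the edges leaving a vertex form a single rotation, so that the two permutations
are those of a map on a closed surface whose vertices are the elements of `ℤ_v`; simplicity makes
the boundary of each face a cycle.

The surface is glued from two triangles for each edge, with corners at a vertex and at the centres
of the two faces along the edge. Every triangle is a copy of the closed unit disc, whose corners are
the cube roots of unity and whose sides are the arcs between them, or a mirror image of such a copy.
At a corner with `2n` triangles around it, a Möbius transformation takes each triangle to a
half-plane, and extracting `n`-th roots turns the half-planes into `2n` sectors of a disc. All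
changes of coordinates between these charts are holomorphic and hence preserve the orientation.
-/

namespace HeffterBiembedding

open Set Metric

section BasicConstruction

variable {ι T X : Type*} (p : ι → Equiv.Perm T) (M : ι → Set X)

/-- The group of permutations of the chambers generated by the mirrors through the point `z`. -/
def mirrorGroup (z : X) : Subgroup (Equiv.Perm T) :=
  Subgroup.closure (p '' {i | z ∈ M i})

/-- The gluing of the chambers of the basic construction: the points over `z` of two chambers are
identified if the mirrors through `z` lead from one chamber to the other. -/
def mirrorSetoid : Setoid (Σ _ : T, X) where
  r a b := a.2 = b.2 ∧ ∃ g ∈ mirrorGroup p M a.2, g a.1 = b.1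
  iseqv :=
    { refl := fun a => ⟨rfl, 1, one_mem _, rfl⟩
      symm := by
        rintro ⟨τ, z⟩ ⟨τ', z'⟩ ⟨rfl, g, hg, rfl⟩
        exact ⟨rfl, g⁻¹, inv_mem hg, g.symm_apply_apply τ⟩
      trans := by
        rintro ⟨τ, z⟩ ⟨τ', z'⟩ ⟨τ'', z''⟩ ⟨rfl, g, hg, rfl⟩ ⟨rfl, g', hg', rfl⟩
        exact ⟨rfl, g' * g, mul_mem hg' hg, rfl⟩ }

/-- Davis' basic construction: copies of the space `X`, called chambers and indexed by `T`, glued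
along the mirrors `M i`, the mirror `M i` of the chamber `τ` to that of the chamber `p i τ`. -/
def BasicConstruction : Type _ := Quotient (mirrorSetoid p M)

namespace BasicConstruction

/-- The point over `z` of the chamber `τ` in the basic construction. -/
def mk (τ : T) (z : X) : BasicConstruction p M := Quotient.mk (mirrorSetoid p M) ⟨τ, z⟩

variable {p M} {τ τ' : T} {z z' : X}

theorem mk_eq_mk_iff :
    mk p M τ z = mk p M τ' z' ↔ z = z' ∧ ∃ g ∈ mirrorGroup p M z, g τ = τ' :=
  Quotient.eq (r := mirrorSetoid p M)

theorem mk_apply_eq {i : ι} (h : z ∈ M i) : mk p M (p i τ) z = mk p M τ z :=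
  (mk_eq_mk_iff.2 ⟨rfl, p i, Subgroup.subset_closure ⟨i, h, rfl⟩, rfl⟩).symm

theorem exists_mk_eq (q : BasicConstruction p M) : ∃ τ z, mk p M τ z = q :=
  Quotient.inductionOn q fun a => ⟨a.1, a.2, rfl⟩

/-- The point of `X` over which a point of the basic construction lies. -/
def toBase (q : BasicConstruction p M) : X :=
  Quotient.lift (s := mirrorSetoid p M) Sigma.snd (fun _ _ h => h.1) q

@[simp]
theorem toBase_mk : toBase (mk p M τ z) = z := rfl

theorem apply_mem_iff_of_mem_mirrorGroup {s : Set T} (hs : ∀ i, z ∈ M i → ∀ τ, p i τ ∈ s ↔ τ ∈ s)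
    {g : Equiv.Perm T} (hg : g ∈ mirrorGroup p M z) (τ : T) : g τ ∈ s ↔ τ ∈ s := by
  induction hg using Subgroup.closure_induction generalizing τ with
  | mem g h =>
    obtain ⟨i, hi, rfl⟩ := h
    exact hs i hi τ
  | one => rfl
  | mul g g' _ _ h h' => exact (h (g' τ)).trans (h' τ)
  | inv g _ h => simpa using (h (g⁻¹ τ)).symm

theorem apply_eq_of_mem_mirrorGroup (h : ∀ i, z ∉ M i) {g : Equiv.Perm T}
    (hg : g ∈ mirrorGroup p M z) (τ : T) : g τ = τ :=
  (apply_mem_iff_of_mem_mirrorGroup (s := {τ}) (fun i hi => absurd hi (h i)) hg τ).2 rfl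

/-- The points over `O` of the chambers in `s`. -/
def chambersOver (p : ι → Equiv.Perm T) (M : ι → Set X) (s : Set T) (O : Set X) :
    Set (BasicConstruction p M) :=
  ⋃ τ ∈ s, mk p M τ '' O

theorem mk_mem_chambersOver_iff {s : Set T} {O : Set X}
    (hs : ∀ i, (O ∩ M i).Nonempty → ∀ τ, p i τ ∈ s ↔ τ ∈ s) :
    mk p M τ z ∈ chambersOver p M s O ↔ τ ∈ s ∧ z ∈ O := by
  simp only [chambersOver, mem_iUnion, mem_image, exists_prop]
  constructor
  · rintro ⟨τ', hτ', z', hz', h⟩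
    obtain ⟨rfl, g, hg, rfl⟩ := mk_eq_mk_iff.1 h
    exact ⟨(apply_mem_iff_of_mem_mirrorGroup (fun i hi => hs i ⟨z', hz', hi⟩) hg τ').2 hτ', hz'⟩
  · exact fun ⟨hτ, hz⟩ => ⟨τ, hτ, z, hz, rfl⟩

variable [TopologicalSpace X]

instance : TopologicalSpace (BasicConstruction p M) :=
  inferInstanceAs (TopologicalSpace (Quotient (mirrorSetoid p M)))

theorem continuous_mk (τ : T) : Continuous (mk p M τ) :=
  continuous_quotient_mk'.comp continuous_sigmaMk

theorem isOpen_iff {U : Set (BasicConstruction p M)} : IsOpen U ↔ ∀ τ, IsOpen (mk p M τ ⁻¹' U) :=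
  isQuotientMap_quotient_mk'.isOpen_preimage.symm.trans isOpen_sigma_iff

theorem continuous_toBase : Continuous (toBase : BasicConstruction p M → X) :=
  Continuous.quotient_lift (continuous_sigma fun _ => continuous_id) _

theorem isOpen_chambersOver {s : Set T} {O : Set X} (hO : IsOpen O)
    (hs : ∀ i, (O ∩ M i).Nonempty → ∀ τ, p i τ ∈ s ↔ τ ∈ s) : IsOpen (chambersOver p M s O) := by
  refine isOpen_iff.2 fun τ => ?_
  have : mk p M τ ⁻¹' chambersOver p M s O = {z | τ ∈ s ∧ z ∈ O} :=
    ext fun z => mk_mem_chambersOver_iff hs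
  rw [this]
  exact isOpen_const.and hO

theorem exists_isOpen_disjoint_mirrors [Finite ι] (hM : ∀ i, IsClosed (M i)) (z : X) :
    ∃ O, IsOpen O ∧ z ∈ O ∧ ∀ i, (O ∩ M i).Nonempty → z ∈ M i := by
  refine ⟨⋂ i : {i // z ∉ M i}, (M i)ᶜ, isOpen_iInter_of_finite fun i => (hM i).isOpen_compl,
    mem_iInter.2 fun i => i.2, fun i ⟨y, hy, hyi⟩ => ?_⟩
  by_contra hz
  exact mem_iInter.1 hy ⟨i, hz⟩ hyi

theorem t2Space [T2Space X] [Finite ι] (hM : ∀ i, IsClosed (M i)) :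
    T2Space (BasicConstruction p M) := by
  refine ⟨fun q q' hne => ?_⟩
  by_cases hbase : toBase q = toBase q'
  swap
  · obtain ⟨U, V, hU, hV, hqU, hqV, hUV⟩ := t2_separation hbase
    exact ⟨_, _, hU.preimage continuous_toBase, hV.preimage continuous_toBase, hqU, hqV,
      hUV.preimage _⟩
  obtain ⟨τ, z, rfl⟩ := exists_mk_eq q
  obtain ⟨τ', z', rfl⟩ := exists_mk_eq q'
  obtain rfl : z = z' := hbase
  obtain ⟨O, hO, hzO, hOM⟩ := exists_isOpen_disjoint_mirrors hM z
  let s : Set T := {σ | ∃ g ∈ mirrorGroup p M z, g τ = σ}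
  have hs : ∀ i, (O ∩ M i).Nonempty → ∀ σ, p i σ ∈ s ↔ σ ∈ s := by
    intro i hi σ
    have hmem : p i ∈ mirrorGroup p M z := Subgroup.subset_closure ⟨i, hOM i hi, rfl⟩
    constructor
    · rintro ⟨g, hg, h⟩
      exact ⟨(p i)⁻¹ * g, mul_mem (inv_mem hmem) hg, by simp [h]⟩
    · rintro ⟨g, hg, rfl⟩
      exact ⟨p i * g, mul_mem hmem hg, rfl⟩
  have hsc : ∀ i, (O ∩ M i).Nonempty → ∀ σ, p i σ ∈ sᶜ ↔ σ ∈ sᶜ := fun i hi σ =>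
    not_congr (hs i hi σ)
  refine ⟨chambersOver p M s O, chambersOver p M sᶜ O, isOpen_chambersOver hO hs,
    isOpen_chambersOver hO hsc, (mk_mem_chambersOver_iff hs).2 ⟨⟨1, one_mem _, rfl⟩, hzO⟩,
    (mk_mem_chambersOver_iff hsc).2 ⟨fun h => hne (mk_eq_mk_iff.2 ⟨rfl, h⟩), hzO⟩, ?_⟩
  rw [Set.disjoint_left]
  intro q hq hq'
  obtain ⟨σ, y, rfl⟩ := exists_mk_eq q
  exact ((mk_mem_chambersOver_iff hsc).1 hq').1 ((mk_mem_chambersOver_iff hs).1 hq).1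

theorem compactSpace [CompactSpace X] [Finite T] : CompactSpace (BasicConstruction p M) :=
  inferInstanceAs (CompactSpace (Quotient (mirrorSetoid p M)))

theorem connectedSpace [ConnectedSpace X] [Nonempty T] (hM : ∀ i, (M i).Nonempty)
    (htrans : ∀ s : Set T, s.Nonempty → (∀ i τ, p i τ ∈ s ↔ τ ∈ s) → s = univ) :
    ConnectedSpace (BasicConstruction p M) := by
  inhabit T
  obtain ⟨x⟩ : Nonempty X := inferInstance
  let q₀ := mk p M default x
  have hchamber : ∀ {τ : T} {y z : X}, mk p M τ y ∈ connectedComponent q₀ →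
      mk p M τ z ∈ connectedComponent q₀ := fun {τ y z} h => by
    rw [connectedComponent_eq h]
    exact (isPreconnected_range (continuous_mk τ)).subset_connectedComponent ⟨y, rfl⟩ ⟨z, rfl⟩
  have huniv := htrans {τ | mk p M τ x ∈ connectedComponent q₀} ⟨default, mem_connectedComponent⟩
    fun i τ => by
      obtain ⟨m, hm⟩ := hM i
      refine ⟨fun h => hchamber (y := m) ?_, fun h => hchamber (y := m) ?_⟩
      · rw [← mk_apply_eq hm]
        exact hchamber h
      · rw [mk_apply_eq hm]
        exact hchamber h
  refine connectedSpace_iff_connectedComponent.2 ⟨q₀, eq_univ_of_forall fun q => ?_⟩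
  obtain ⟨τ, z, rfl⟩ := exists_mk_eq q
  exact hchamber (y := x) (eq_univ_iff_forall.1 huniv τ)

end BasicConstruction

end BasicConstruction

section Triangle

open ComplexConjugate

/-- The corners of the model triangle: the cube roots of unity. -/
noncomputable def corner (i : ZMod 3) : ℂ := ZMod.stdAddChar i

theorem corner_zero : corner 0 = 1 := AddChar.map_zero_eq_one _

theorem corner_add (i j : ZMod 3) : corner (i + j) = corner i * corner j :=
  AddChar.map_add_eq_mul _ i j

theorem norm_corner (i : ZMod 3) : ‖corner i‖ = 1 := AddChar.norm_apply _ i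

theorem corner_neg_mul_corner (i : ZMod 3) : corner (-i) * corner i = 1 := by
  rw [← corner_add, neg_add_cancel, corner_zero]

theorem corner_ne_zero (i : ZMod 3) : corner i ≠ 0 := fun h => by
  simpa [h] using corner_neg_mul_corner i

theorem conj_corner (i : ZMod 3) : conj (corner i) = corner (-i) := by
  rw [← Complex.inv_eq_conj (norm_corner i), eq_comm]
  exact eq_inv_of_mul_eq_one_left (corner_neg_mul_corner i)

theorem corner_one : corner 1 = ⟨-1 / 2, √3 / 2⟩ := by
  have h : corner 1 = Complex.exp ((2 * Real.pi / 3 : ℝ) * Complex.I) := by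
    have := ZMod.stdAddChar_coe (N := 3) 1
    simp only [Int.cast_one] at this
    rw [corner, this]
    push_cast
    ring_nf
  have harg : 2 * Real.pi / 3 = Real.pi - Real.pi / 3 := by ring
  rw [h, harg]
  apply Complex.ext
  · rw [Complex.exp_ofReal_mul_I_re, Real.cos_pi_sub, Real.cos_pi_div_three]
    norm_num
  · rw [Complex.exp_ofReal_mul_I_im, Real.sin_pi_sub, Real.sin_pi_div_three]

theorem corner_two : corner 2 = ⟨-1 / 2, -(√3 / 2)⟩ := by
  rw [show (2 : ZMod 3) = -1 from rfl, ← conj_corner, corner_one]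
  rfl

theorem corner_injective : Function.Injective corner :=
  ZMod.injective_stdAddChar

/-- The model triangle: the closed unit disc, with corners at the cube roots of unity. -/
abbrev Triangle : Type := closedBall (0 : ℂ) 1

theorem norm_le_one (z : Triangle) : ‖(z : ℂ)‖ ≤ 1 := mem_closedBall_zero_iff.1 z.2

/-- The side of the model triangle opposite to the corner `i`: an arc of the unit circle. -/
def side (i : ZMod 3) : Set Triangle := {z | ‖(z : ℂ)‖ = 1 ∧ (corner (-i) * z).re ≤ -1 / 2}

theorem isClosed_side (i : ZMod 3) : IsClosed (side i) :=
  IsClosed.inter (isClosed_eq (continuous_norm.comp continuous_subtype_val) continuous_const)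
    (isClosed_le (Complex.continuous_re.comp (continuous_const.mul continuous_subtype_val))
      continuous_const)

theorem side_nonempty (i : ZMod 3) : (side i).Nonempty := by
  refine ⟨⟨-corner i, by simp [norm_corner]⟩, by simp [norm_corner], ?_⟩
  rw [mul_neg, corner_neg_mul_corner]
  norm_num

/-- The folding of the plane onto the upper half-plane along the real axis. -/
def fold (v : ℂ) : ℂ := ⟨v.re, |v.im|⟩

theorem continuous_fold : Continuous fold :=
  Complex.equivRealProdCLM.symm.continuous.comp
    (Complex.continuous_re.prodMk (continuous_abs.comp Complex.continuous_im))

theorem norm_fold (v : ℂ) : ‖fold v‖ = ‖v‖ := by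
  simp [Complex.norm_def, Complex.normSq_apply, fold]

theorem fold_of_im_nonneg {v : ℂ} (h : 0 ≤ v.im) : fold v = v :=
  Complex.ext rfl (abs_of_nonneg h)

theorem fold_of_im_nonpos {v : ℂ} (h : v.im ≤ 0) : fold v = conj v :=
  Complex.ext rfl (abs_of_nonpos h)

/-- The shape of a disc neighbourhood of a corner of the model triangle. The neighbourhood is
bounded by an arc of a circle through the point `α / conj α` orthogonal to the sides; the inequality
keeps it away from the interior of the opposite side. -/
structure Aperture where
  val : ℂ
  im_pos : 0 < val.im
  im_add_le : val.im + √3 * |val.re| ≤ √3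

variable (α : Aperture)

/-- The folding map of a corner: it maps the upper half-plane conformally onto the model triangle,
`0` to the corner `1` and the real axis to the sides, and is invariant under conjugation. -/
noncomputable def foldMap (v : ℂ) : ℂ := (1 + α.val * fold v) / (1 + conj α.val * fold v)

theorem normSq_one_add_conj_mul_sub (a f : ℂ) :
    Complex.normSq (1 + conj a * f) - Complex.normSq (1 + a * f) = 4 * a.im * f.im := by
  simp only [Complex.normSq_apply, Complex.add_re, Complex.add_im, Complex.mul_re, Complex.mul_im,
    Complex.conj_re, Complex.conj_im, Complex.one_re, Complex.one_im]
  ring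

theorem Aperture.sub_conj_ne_zero : α.val - conj α.val ≠ 0 := by
  rw [Complex.sub_conj]
  simp [α.im_pos.ne']

theorem one_add_conj_mul_fold_ne_zero (v : ℂ) : 1 + conj α.val * fold v ≠ 0 := by
  intro h
  have hnum : Complex.normSq (1 + α.val * fold v) = 0 := by
    have hle := normSq_one_add_conj_mul_sub α.val (fold v)
    rw [h, map_zero] at hle
    have : 0 ≤ 4 * α.val.im * (fold v).im :=
      mul_nonneg (mul_nonneg (by norm_num) α.im_pos.le) (abs_nonneg _)
    linarith [Complex.normSq_nonneg (1 + α.val * fold v)]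
  rw [Complex.normSq_eq_zero] at hnum
  have hmul : (α.val - conj α.val) * fold v = 0 := by linear_combination hnum - h
  have hfold := (mul_eq_zero.1 hmul).resolve_left α.sub_conj_ne_zero
  simp [hfold] at h

theorem foldMap_mul (v : ℂ) :
    foldMap α v * (1 + conj α.val * fold v) = 1 + α.val * fold v :=
  div_mul_cancel₀ _ (one_add_conj_mul_fold_ne_zero α v)

theorem norm_foldMap_sq (v : ℂ) :
    ‖foldMap α v‖ ^ 2 =
      1 - 4 * α.val.im * |v.im| / Complex.normSq (1 + conj α.val * fold v) := by
  have hpos := Complex.normSq_pos.2 (one_add_conj_mul_fold_ne_zero α v)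
  rw [foldMap, ← Complex.normSq_eq_norm_sq, map_div₀, div_eq_iff hpos.ne', sub_mul, one_mul,
    div_mul_cancel₀ _ hpos.ne']
  have h := normSq_one_add_conj_mul_sub α.val (fold v)
  rw [show (fold v).im = |v.im| from rfl] at h
  linear_combination -h

theorem norm_foldMap_le_one (v : ℂ) : ‖foldMap α v‖ ≤ 1 := by
  rw [← sq_le_one_iff₀ (norm_nonneg _), norm_foldMap_sq]
  have := α.im_pos
  have := Complex.normSq_nonneg (1 + conj α.val * fold v)
  have : 0 ≤ 4 * α.val.im * |v.im| / Complex.normSq (1 + conj α.val * fold v) := by positivity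
  linarith

theorem norm_foldMap_eq_one_iff (v : ℂ) : ‖foldMap α v‖ = 1 ↔ v.im = 0 := by
  rw [← sq_eq_sq₀ (norm_nonneg _) zero_le_one, norm_foldMap_sq, one_pow, sub_eq_self,
    div_eq_zero_iff,
    or_iff_left (Complex.normSq_pos.2 (one_add_conj_mul_fold_ne_zero α v)).ne', mul_eq_zero,
    or_iff_right (by have := α.im_pos; positivity), abs_eq_zero]

theorem foldMap_sub_one (v : ℂ) :
    foldMap α v - 1 = fold v * (α.val - conj α.val * foldMap α v) := by
  linear_combination foldMap_mul α v

theorem sub_conj_mul_foldMap_ne_zero (v : ℂ) : α.val - conj α.val * foldMap α v ≠ 0 := by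
  refine left_ne_zero_of_mul (b := 1 + conj α.val * fold v) ?_
  have h : (α.val - conj α.val * foldMap α v) * (1 + conj α.val * fold v) =
      α.val - conj α.val := by
    linear_combination -conj α.val * foldMap_mul α v
  exact h ▸ α.sub_conj_ne_zero

theorem foldMap_eq_foldMap_iff {v v' : ℂ} : foldMap α v = foldMap α v' ↔ fold v = fold v' := by
  refine ⟨fun h => ?_, fun h => by rw [foldMap, foldMap, h]⟩
  have h' := foldMap_sub_one α v
  rw [h, foldMap_sub_one α v'] at h'
  exact (mul_right_cancel₀ (sub_conj_mul_foldMap_ne_zero α v') h').symm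

theorem exists_foldMap_eq {z : ℂ} (hz : ‖z‖ ≤ 1) (h : α.val - conj α.val * z ≠ 0) :
    ∃ v : ℂ, 0 ≤ v.im ∧ foldMap α v = z := by
  set v := (z - 1) / (α.val - conj α.val * z) with hv
  have hvz : v * (α.val - conj α.val * z) = z - 1 := div_mul_cancel₀ _ h
  have hden : 1 + conj α.val * v ≠ 0 := fun h0 => α.sub_conj_ne_zero (by
    linear_combination (α.val - conj α.val * z) * h0 - conj α.val * hvz)
  have hz_eq : z = (1 + α.val * v) / (1 + conj α.val * v) := by
    rw [eq_div_iff hden]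
    linear_combination -hvz
  have him : 0 ≤ v.im := by
    have hle : Complex.normSq (1 + α.val * v) ≤ Complex.normSq (1 + conj α.val * v) := by
      rw [Complex.normSq_eq_norm_sq, Complex.normSq_eq_norm_sq]
      gcongr
      rwa [hz_eq, norm_div, div_le_one (norm_pos_iff.2 hden)] at hz
    have := normSq_one_add_conj_mul_sub α.val v
    exact nonneg_of_mul_nonneg_right (by linarith : 0 ≤ 4 * α.val.im * v.im)
      (by linarith [α.im_pos])
  exact ⟨v, him, by rw [foldMap, fold_of_im_nonneg him, ← hz_eq]⟩

theorem continuous_foldMap : Continuous (foldMap α) :=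
  .div (by have := continuous_fold; fun_prop) (by have := continuous_fold; fun_prop)
    (one_add_conj_mul_fold_ne_zero α)

/-- The folding map of the corner `i` of the model triangle. -/
noncomputable def foldPoint (i : ZMod 3) (v : ℂ) : Triangle :=
  ⟨corner i * foldMap α v, by
    rw [mem_closedBall_zero_iff, norm_mul, norm_corner, one_mul]
    exact norm_foldMap_le_one α v⟩

theorem continuous_foldPoint (i : ZMod 3) : Continuous (foldPoint α i) :=
  (continuous_const.mul (continuous_foldMap α)).subtype_mk _

theorem corner_neg_mul_foldPoint (i : ZMod 3) (v : ℂ) :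
    corner (-i) * foldPoint α i v = foldMap α v := by
  rw [foldPoint, ← mul_assoc, corner_neg_mul_corner, one_mul]

theorem foldPoint_eq_foldPoint_iff (i : ZMod 3) {v v' : ℂ} :
    foldPoint α i v = foldPoint α i v' ↔ fold v = fold v' := by
  rw [← foldMap_eq_foldMap_iff α, Subtype.ext_iff]
  exact mul_right_inj' (corner_ne_zero i)

/-- A function on the model triangle that is negative, zero or positive at the image of `v` under
the folding map of the corner `i` as `v` lies inside, on or outside the unit circle. -/
noncomputable def excess (i : ZMod 3) (z : Triangle) : ℝ :=
  ‖corner (-i) * z - 1‖ - ‖α.val - conj α.val * (corner (-i) * z)‖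

theorem continuous_excess (i : ZMod 3) : Continuous (excess α i) := by
  unfold excess
  fun_prop

theorem excess_foldPoint (i : ZMod 3) (v : ℂ) :
    excess α i (foldPoint α i v) =
      (‖v‖ - 1) * ‖α.val - conj α.val * foldMap α v‖ := by
  rw [excess, corner_neg_mul_foldPoint, foldMap_sub_one, norm_mul, norm_fold, sub_one_mul]

theorem excess_foldPoint_neg_iff (i : ZMod 3) (v : ℂ) :
    excess α i (foldPoint α i v) < 0 ↔ ‖v‖ < 1 := by
  rw [excess_foldPoint, mul_comm, ← smul_eq_mul,
    smul_neg_iff_of_pos_left (norm_pos_iff.2 (sub_conj_mul_foldMap_ne_zero α v)), sub_neg]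

theorem excess_foldPoint_eq_zero_iff (i : ZMod 3) (v : ℂ) :
    excess α i (foldPoint α i v) = 0 ↔ ‖v‖ = 1 := by
  rw [excess_foldPoint, mul_eq_zero,
    or_iff_left (norm_pos_iff.2 (sub_conj_mul_foldMap_ne_zero α v)).ne', sub_eq_zero]

theorem exists_foldPoint_eq (i : ZMod 3) {z : Triangle} (hz : excess α i z ≤ 0) :
    ∃ v : ℂ, 0 ≤ v.im ∧ foldPoint α i v = z := by
  have hne : α.val - conj α.val * (corner (-i) * z) ≠ 0 := fun h => by
    rw [excess, h, norm_zero, sub_zero, norm_le_zero_iff, sub_eq_zero] at hz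
    exact α.sub_conj_ne_zero (by simpa [hz] using h)
  obtain ⟨v, hv, h⟩ := exists_foldMap_eq α
    (by simpa only [norm_mul, norm_corner, one_mul] using norm_le_one z) hne
  refine ⟨v, hv, Subtype.ext ?_⟩
  change corner i * foldMap α v = z
  rw [h, ← mul_assoc, mul_comm (corner i), corner_neg_mul_corner, one_mul]

theorem foldPoint_mem_side_iff (i j : ZMod 3) {v : ℂ} :
    foldPoint α i v ∈ side (i + j) ↔ v.im = 0 ∧
      (corner (-j) * (1 + α.val * v.re) ^ 2).re ≤ -Complex.normSq (1 + α.val * v.re) / 2 := by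
  have hrot : corner (-(i + j)) * foldPoint α i v = corner (-j) * foldMap α v := by
    rw [neg_add_rev, corner_add, mul_assoc, corner_neg_mul_foldPoint]
  have hnorm : ‖(foldPoint α i v : ℂ)‖ = 1 ↔ v.im = 0 := by
    rw [← norm_foldMap_eq_one_iff α, ← corner_neg_mul_foldPoint α i, norm_mul, norm_corner, one_mul]
  refine (and_congr hnorm (by rw [hrot])).trans (and_congr_right fun hv => ?_)
  have hreal : fold v = v.re := Complex.ext rfl (by simp [fold, hv])
  have hconj : 1 + conj α.val * v.re = conj (1 + α.val * v.re) := by simp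
  have hpos : 0 < Complex.normSq (1 + α.val * v.re) := by
    rw [← Complex.normSq_conj, ← hconj, ← hreal]
    exact Complex.normSq_pos.2 (one_add_conj_mul_fold_ne_zero α v)
  have hmul : foldMap α v * Complex.normSq (1 + α.val * v.re) = (1 + α.val * v.re) ^ 2 := by
    have h := foldMap_mul α v
    rw [hreal, hconj] at h
    rw [← Complex.mul_conj, mul_left_comm, h, sq]
  rw [← hmul, ← mul_assoc, Complex.re_mul_ofReal, ← mul_le_mul_iff_left₀ hpos, div_mul_eq_mul_div,
    neg_one_mul]

theorem foldPoint_mem_side_iff_sq_le (i : ZMod 3) {v : ℂ} :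
    foldPoint α i v ∈ side i ↔
      v.im = 0 ∧ 3 * (1 + α.val.re * v.re) ^ 2 ≤ (α.val.im * v.re) ^ 2 := by
  have h := foldPoint_mem_side_iff α i 0 (v := v)
  rw [add_zero] at h
  rw [h, neg_zero, corner_zero]
  refine and_congr_right fun _ => ?_
  simp only [Complex.normSq_apply, sq, one_mul, Complex.mul_re, Complex.mul_im, Complex.add_re,
    Complex.add_im, Complex.one_re, Complex.one_im, Complex.ofReal_re, Complex.ofReal_im, mul_zero,
    sub_zero, zero_add]
  constructor <;> intro h <;> linarith

theorem foldPoint_mem_side_add_one_iff (i : ZMod 3) {v : ℂ} :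
    foldPoint α i v ∈ side (i + 1) ↔ v.im = 0 ∧
      α.val.im * v.re * (√3 * (1 + α.val.re * v.re) + α.val.im * v.re) ≤ 0 := by
  rw [foldPoint_mem_side_iff, ← conj_corner, corner_one]
  refine and_congr_right fun _ => ?_
  simp only [Complex.normSq_apply, sq, Complex.conj_re, Complex.conj_im, Complex.mul_re,
    Complex.mul_im, Complex.add_re, Complex.add_im, Complex.one_re, Complex.one_im,
    Complex.ofReal_re, Complex.ofReal_im, mul_zero, sub_zero, zero_add]
  constructor <;> intro h <;> linarith

theorem foldPoint_mem_side_add_two_iff (i : ZMod 3) {v : ℂ} :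
    foldPoint α i v ∈ side (i + 2) ↔ v.im = 0 ∧
      0 ≤ α.val.im * v.re * (√3 * (1 + α.val.re * v.re) - α.val.im * v.re) := by
  rw [foldPoint_mem_side_iff, ← conj_corner, corner_two]
  refine and_congr_right fun _ => ?_
  simp only [Complex.normSq_apply, sq, Complex.conj_re, Complex.conj_im, Complex.mul_re,
    Complex.mul_im, Complex.add_re, Complex.add_im, Complex.one_re, Complex.one_im,
    Complex.ofReal_re, Complex.ofReal_im, mul_zero, sub_zero, zero_add]
  constructor <;> intro h <;> linarith

variable {α} {v : ℂ}

theorem Aperture.im_le_of_norm_le_one (hv : ‖v‖ ≤ 1) :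
    α.val.im ≤ √3 * (1 + α.val.re * v.re) := by
  have habs : |α.val.re * v.re| ≤ |α.val.re| := by
    rw [abs_mul]
    exact mul_le_of_le_one_right (abs_nonneg _) ((Complex.abs_re_le_norm v).trans hv)
  have hre := neg_le_of_abs_le habs
  calc α.val.im ≤ √3 * (1 + -|α.val.re|) := by linarith [α.im_add_le]
    _ ≤ √3 * (1 + α.val.re * v.re) := by gcongr

theorem abs_im_mul_re_le (hv : ‖v‖ ≤ 1) : |α.val.im * v.re| ≤ √3 * (1 + α.val.re * v.re) := by
  rw [abs_mul, abs_of_pos α.im_pos]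
  exact (mul_le_of_le_one_right α.im_pos.le ((Complex.abs_re_le_norm v).trans hv)).trans
    (Aperture.im_le_of_norm_le_one hv)

theorem abs_im_mul_re_lt (hv : ‖v‖ < 1) : |α.val.im * v.re| < √3 * (1 + α.val.re * v.re) := by
  rw [abs_mul, abs_of_pos α.im_pos]
  exact (mul_lt_of_lt_one_right α.im_pos ((Complex.abs_re_le_norm v).trans_lt hv)).trans_le
    (Aperture.im_le_of_norm_le_one hv.le)

theorem foldPoint_mem_side_add_one {i : ZMod 3} (hv : ‖v‖ ≤ 1) (him : v.im = 0) (hre : v.re ≤ 0) :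
    foldPoint α i v ∈ side (i + 1) := by
  have h := neg_le_of_abs_le (abs_im_mul_re_le (α := α) hv)
  refine (foldPoint_mem_side_add_one_iff α i).2 ⟨him, mul_nonpos_of_nonpos_of_nonneg
    (mul_nonpos_of_nonneg_of_nonpos α.im_pos.le hre) (by linarith)⟩

theorem foldPoint_mem_side_add_two {i : ZMod 3} (hv : ‖v‖ ≤ 1) (him : v.im = 0) (hre : 0 ≤ v.re) :
    foldPoint α i v ∈ side (i + 2) := by
  have h := le_of_abs_le (abs_im_mul_re_le (α := α) hv)
  exact (foldPoint_mem_side_add_two_iff α i).2 ⟨him, mul_nonneg (mul_nonneg α.im_pos.le hre)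
    (by linarith)⟩

theorem foldPoint_notMem_side (i : ZMod 3) (hv : ‖v‖ < 1) : foldPoint α i v ∉ side i := by
  rw [foldPoint_mem_side_iff_sq_le]
  rintro ⟨-, h⟩
  have := sq_lt_sq.2 ((abs_im_mul_re_lt (α := α) hv).trans_le (le_abs_self _))
  rw [mul_pow √3, Real.sq_sqrt (by norm_num)] at this
  linarith

theorem im_eq_zero_of_foldPoint_mem_side {i j : ZMod 3} (h : foldPoint α i v ∈ side j) :
    v.im = 0 := by
  rw [← add_sub_cancel i j, foldPoint_mem_side_iff] at h
  exact h.1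

theorem re_nonpos_of_foldPoint_mem_side {i : ZMod 3} (hv : ‖v‖ < 1)
    (h : foldPoint α i v ∈ side (i + 1)) : v.re ≤ 0 := by
  have hlt := neg_lt_of_abs_lt (abs_im_mul_re_lt (α := α) hv)
  have hle := nonpos_of_mul_nonpos_left ((foldPoint_mem_side_add_one_iff α i).1 h).2 (by linarith)
  exact nonpos_of_mul_nonpos_right hle α.im_pos

theorem re_nonneg_of_foldPoint_mem_side {i : ZMod 3} (hv : ‖v‖ < 1)
    (h : foldPoint α i v ∈ side (i + 2)) : 0 ≤ v.re := by
  have hlt := lt_of_abs_lt (abs_im_mul_re_lt (α := α) hv)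
  have hle := nonneg_of_mul_nonneg_left ((foldPoint_mem_side_add_two_iff α i).1 h).2 (by linarith)
  exact nonneg_of_mul_nonneg_right hle α.im_pos

end Triangle

section Gallery

theorem eq_add_one_or_eq_add_two {i j : ZMod 3} : j ≠ i → j = i + 1 ∨ j = i + 2 := by
  revert i j
  decide

variable {E : Type} (a : ZMod 3 → Equiv.Perm E)

/-- The chamber on the other side of the mirror `i`. The chambers are the elements of `E` in two
colours, and the mirror `i` separates the chamber `e` of colour `true` from the chamber `a i e` of
colour `false`. -/
def mirrorSwap (i : ZMod 3) : Equiv.Perm (E × Bool) :=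
  Function.Involutive.toPerm
    (fun τ => (if τ.2 then a i τ.1 else (a i)⁻¹ τ.1, !τ.2)) (by rintro ⟨e, _ | _⟩ <;> simp)

@[simp]
theorem mirrorSwap_true (i : ZMod 3) (e : E) : mirrorSwap a i (e, true) = (a i e, false) := rfl

@[simp]
theorem mirrorSwap_false (i : ZMod 3) (e : E) : mirrorSwap a i (e, false) = ((a i)⁻¹ e, true) := rfl

theorem mirrorSwap_mirrorSwap (i : ZMod 3) (τ : E × Bool) :
    mirrorSwap a i (mirrorSwap a i τ) = τ := by
  rcases τ with ⟨e, _ | _⟩ <;> simp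

theorem mirrorSwap_snd (i : ZMod 3) (τ : E × Bool) : (mirrorSwap a i τ).2 = !τ.2 := rfl

/-- The closed surface triangulated by two triangles for each element of `E`, which are glued
according to `a`. -/
abbrev TriangulatedSurface : Type := BasicConstruction (mirrorSwap a) side

/-- The permutation of the chambers of colour `true` that turns them around the corner `i`. -/
def rotation (i : ZMod 3) : Equiv.Perm E := (a (i + 2))⁻¹ * a (i + 1)

/-- The cyclic sequence of the chambers around the corner `i` of the chamber `e` of colour `true`.
The mirror `i + 1` separates the chambers `2 * j` and `2 * j + 1`, and the mirror `i + 2` the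
chambers `2 * j - 1` and `2 * j`. -/
def gallery (i : ZMod 3) (e : E) (k : ℤ) : E × Bool :=
  if Even k then ((rotation a i ^ (k / 2)) e, true)
  else (a (i + 1) ((rotation a i ^ (k / 2)) e), false)

/-- Half the number of the chambers around the corner `i` of the chamber `e`. -/
noncomputable def valency (i : ZMod 3) (e : E) : ℕ := MulAction.period (rotation a i) e

variable {a} {i : ZMod 3} {e : E}

theorem valency_pos [Finite E] : 0 < valency a i e :=
  MulAction.period_pos_of_orderOf_pos (orderOf_pos _) e

theorem gallery_two_mul (j : ℤ) : gallery a i e (2 * j) = ((rotation a i ^ j) e, true) := by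
  rw [gallery, if_pos (even_two_mul j), Int.mul_ediv_cancel_left _ two_ne_zero]

theorem gallery_two_mul_add_one (j : ℤ) :
    gallery a i e (2 * j + 1) = (a (i + 1) ((rotation a i ^ j) e), false) := by
  rw [gallery, if_neg (by simp), show (2 * j + 1) / 2 = j by omega]

theorem gallery_zero : gallery a i e 0 = (e, true) := gallery_two_mul 0

theorem gallery_snd (k : ℤ) : (gallery a i e k).2 = decide (Even k) := by
  unfold gallery
  split_ifs with h <;> simp [h]

theorem mirrorSwap_gallery_two_mul (j : ℤ) :
    mirrorSwap a (i + 1) (gallery a i e (2 * j)) = gallery a i e (2 * j + 1) := by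
  rw [gallery_two_mul, gallery_two_mul_add_one, mirrorSwap_true]

theorem mirrorSwap_gallery_two_mul_sub_one (j : ℤ) :
    mirrorSwap a (i + 2) (gallery a i e (2 * j - 1)) = gallery a i e (2 * j) := by
  obtain ⟨l, rfl⟩ : ∃ l, j = 1 + l := ⟨j - 1, by ring⟩
  rw [show 2 * (1 + l) - 1 = 2 * l + 1 by ring, gallery_two_mul_add_one, gallery_two_mul,
    mirrorSwap_false, zpow_one_add]
  rfl

theorem gallery_eq_gallery_iff {k k' : ℤ} :
    gallery a i e k = gallery a i e k' ↔ ((2 * valency a i e : ℕ) : ℤ) ∣ k - k' := by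
  have hpow : ∀ j j' : ℤ, (rotation a i ^ j) e = (rotation a i ^ j') e ↔
      (2 * valency a i e : ℤ) ∣ 2 * j - 2 * j' := fun j j' => by
    rw [← mul_sub, mul_dvd_mul_iff_left two_ne_zero, valency,
      ← MulAction.zpow_smul_eq_iff_period_dvd, sub_eq_neg_add, zpow_add, zpow_neg, mul_smul,
      inv_smul_eq_iff]
    rfl
  push_cast
  rcases Int.even_or_odd' k with ⟨j, rfl | rfl⟩ <;> rcases Int.even_or_odd' k' with ⟨j', rfl | rfl⟩
  · simp [gallery_two_mul, hpow]
  · simp only [gallery_two_mul, gallery_two_mul_add_one, Prod.mk.injEq, Bool.true_eq_false,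
      and_false, false_iff]
    exact fun h => by have := (Dvd.intro _ rfl).trans h; omega
  · simp only [gallery_two_mul, gallery_two_mul_add_one, Prod.mk.injEq, Bool.false_eq_true,
      and_false, false_iff]
    exact fun h => by have := (Dvd.intro _ rfl).trans h; omega
  · simp [gallery_two_mul_add_one, hpow]

theorem mem_range_gallery_iff {e' : E} :
    (e', true) ∈ range (gallery a i e) ↔ (rotation a i).SameCycle e e' := by
  constructor
  · rintro ⟨k, hk⟩
    rcases Int.even_or_odd' k with ⟨j, rfl | rfl⟩
    · exact ⟨j, (Prod.ext_iff.1 ((gallery_two_mul j).symm.trans hk)).1⟩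
    · simp [gallery_two_mul_add_one] at hk
  · rintro ⟨j, rfl⟩
    exact ⟨2 * j, gallery_two_mul j⟩

theorem mirrorSwap_mem_range_gallery_iff {j : ZMod 3} (hj : j ≠ i) (τ : E × Bool) :
    mirrorSwap a j τ ∈ range (gallery a i e) ↔ τ ∈ range (gallery a i e) := by
  suffices h : ∀ k, mirrorSwap a j (gallery a i e k) ∈ range (gallery a i e) by
    refine ⟨?_, ?_⟩
    · rintro ⟨k, hk⟩
      simpa [hk, mirrorSwap_mirrorSwap] using h k
    · rintro ⟨k, rfl⟩
      exact h k
  intro k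
  rcases eq_add_one_or_eq_add_two hj with rfl | rfl <;>
    rcases Int.even_or_odd' k with ⟨l, rfl | rfl⟩
  · exact ⟨_, (mirrorSwap_gallery_two_mul l).symm⟩
  · rw [← mirrorSwap_gallery_two_mul, mirrorSwap_mirrorSwap]
    exact mem_range_self _
  · rw [← mirrorSwap_gallery_two_mul_sub_one, mirrorSwap_mirrorSwap]
    exact mem_range_self _
  · rw [show 2 * l + 1 = 2 * (l + 1) - 1 by ring, mirrorSwap_gallery_two_mul_sub_one]
    exact mem_range_self _

end Gallery

section Charts

theorem continuousOn_of_comp_eq {κ Y Z : Type*} [TopologicalSpace κ] [CompactSpace κ]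
    [TopologicalSpace Y] [T2Space Y] [TopologicalSpace Z] {p : κ → Y} {h : κ → Z} {c : Y → Z}
    {s : Set Y} (hp : Continuous p) (hh : Continuous h) (hs : s ⊆ range p)
    (hc : ∀ a, p a ∈ s → c (p a) = h a) : ContinuousOn c s := by
  rw [continuousOn_iff_isClosed]
  intro t ht
  refine ⟨p '' (h ⁻¹' t), ((ht.preimage hh).isCompact.image hp).isClosed, ?_⟩
  ext y
  constructor
  · rintro ⟨hy, hys⟩
    obtain ⟨a, rfl⟩ := hs hys
    exact ⟨⟨a, by rwa [mem_preimage, hc a hys] at hy, rfl⟩, hys⟩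
  · rintro ⟨⟨a, ha, rfl⟩, hys⟩
    exact ⟨by rwa [mem_preimage, hc a hys], hys⟩

theorem exists_apply_eq_of_forall_eq {κ Y Z : Type*} [Nonempty Z] {p : κ → Y} {h : κ → Z}
    {s : Set κ} (hker : ∀ a ∈ s, ∀ b ∈ s, p a = p b → h a = h b) :
    ∃ c : Y → Z, ∀ a ∈ s, c (p a) = h a := by
  have hf : Function.FactorsThrough (fun a : s => h a) fun a : s => p a :=
    fun a b => hker a a.2 b b.2
  exact ⟨Function.extend (fun a : s => p a) (fun a : s => h a) fun _ => Classical.arbitrary Z,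
    fun a ha => hf.extend_apply _ ⟨a, ha⟩⟩

theorem exists_openPartialHomeomorph_of_comp_eq {κ S Z : Type*} [TopologicalSpace κ]
    [CompactSpace κ] [Nonempty κ] [TopologicalSpace S] [T2Space S] [TopologicalSpace Z] [T2Space Z]
    {p : κ → S} {h : κ → Z} {O : Set Z} (hp : Continuous p) (hh : Continuous h) (hO : IsOpen O)
    (hOh : O ⊆ range h) (hker : ∀ a, h a ∈ O → ∀ b, p a = p b ↔ h a = h b)
    (hopen : IsOpen (p '' (h ⁻¹' O))) :
    ∃ c : OpenPartialHomeomorph S Z, c.source = p '' (h ⁻¹' O) ∧ c.target = O ∧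
      ∀ a, h a ∈ O → c (p a) = h a := by
  have : Nonempty Z := ‹Nonempty κ›.map h
  have : Nonempty S := ‹Nonempty κ›.map p
  obtain ⟨c, hc⟩ := exists_apply_eq_of_forall_eq (p := p) (h := h) (s := h ⁻¹' O)
    fun a ha b _ => (hker a ha b).1
  obtain ⟨d, hd⟩ := exists_apply_eq_of_forall_eq (p := h) (h := p) (s := h ⁻¹' O)
    fun a ha b _ => (hker a ha b).2
  have hsat : ∀ b, p b ∈ p '' (h ⁻¹' O) → h b ∈ O := by
    rintro b ⟨a, ha, hab⟩
    rwa [← (hker a ha b).1 hab]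
  refine ⟨{ toFun := c, invFun := d, source := p '' (h ⁻¹' O), target := O
            map_source' := ?_, map_target' := ?_, left_inv' := ?_, right_inv' := ?_
            open_source := hopen, open_target := hO
            continuousOn_toFun := continuousOn_of_comp_eq hp hh (image_subset_range _ _)
              fun a ha => hc a (hsat a ha)
            continuousOn_invFun := continuousOn_of_comp_eq hh hp hOh hd }, rfl, rfl, hc⟩
  · rintro _ ⟨a, ha, rfl⟩
    rwa [hc a ha]
  · intro w hw
    obtain ⟨a, rfl⟩ := hOh hw
    exact ⟨a, hw, (hd a hw).symm⟩
  · rintro _ ⟨a, ha, rfl⟩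
    rw [hc a ha, hd a ha]
  · intro w hw
    obtain ⟨a, rfl⟩ := hOh hw
    rw [hd a hw, hc a hw]

end Charts

section Wheel

open BasicConstruction

/-- Polar coordinates in the disc, `x` being the angle in units of `π / n`. -/
noncomputable def spoke (n : ℕ) (r x : ℝ) : ℂ := r * Complex.exp (Real.pi * x / n * Complex.I)

theorem norm_spoke (n : ℕ) {r : ℝ} (hr : 0 ≤ r) (x : ℝ) : ‖spoke n r x‖ = r := by
  have : (Real.pi * x / n * Complex.I : ℂ) = (Real.pi * x / n : ℝ) * Complex.I := by push_cast; rfl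
  rw [spoke, norm_mul, this, Complex.norm_exp_ofReal_mul_I, mul_one, Complex.norm_of_nonneg hr]

theorem spoke_pow {n : ℕ} (hn : 0 < n) (r x : ℝ) : spoke n r x ^ n = spoke 1 (r ^ n) x := by
  have : (n : ℂ) ≠ 0 := by exact_mod_cast hn.ne'
  rw [spoke, spoke, mul_pow, ← Complex.exp_nat_mul]
  push_cast
  congr 2
  field_simp

theorem spoke_eq_spoke_iff {n : ℕ} (hn : 0 < n) {r : ℝ} (hr : 0 < r) (x x' : ℝ) :
    spoke n r x = spoke n r x' ↔ ∃ q : ℤ, x - x' = 2 * n * q := by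
  have hn' : (n : ℂ) ≠ 0 := by exact_mod_cast hn.ne'
  have hπ : (Real.pi : ℂ) ≠ 0 := by exact_mod_cast Real.pi_ne_zero
  rw [spoke, spoke, mul_right_inj' (by exact_mod_cast hr.ne'), Complex.exp_eq_exp_iff_exists_int]
  refine exists_congr fun q => ⟨fun h => ?_, fun h => ?_⟩
  · have h' : (x - x' : ℂ) = 2 * n * q := by
      refine mul_left_cancel₀ (mul_ne_zero hπ Complex.I_ne_zero) ?_
      field_simp at h
      linear_combination Real.pi * Complex.I * h
    exact_mod_cast h'
  · have h' : (x : ℂ) = x' + 2 * n * q := by exact_mod_cast eq_add_of_sub_eq' h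
    rw [h']
    field_simp

theorem spoke_add_two_mul_mul {n : ℕ} (hn : 0 < n) (r x : ℝ) (q : ℤ) :
    spoke n r (x + 2 * n * q) = spoke n r x := by
  have hn' : (n : ℂ) ≠ 0 := by exact_mod_cast hn.ne'
  have harg : (Real.pi * (x + 2 * n * q : ℝ) / n * Complex.I : ℂ) =
      Real.pi * x / n * Complex.I + q * (2 * Real.pi * Complex.I) := by
    push_cast
    field_simp
  rw [spoke, spoke, harg, Complex.exp_add, Complex.exp_int_mul_two_pi_mul_I, mul_one]

theorem spoke_arg {n : ℕ} (hn : 0 < n) (z : ℂ) : spoke n ‖z‖ (n * (z.arg / Real.pi)) = z := by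
  have hn' : (n : ℂ) ≠ 0 := by exact_mod_cast hn.ne'
  have hπ : (Real.pi : ℂ) ≠ 0 := by exact_mod_cast Real.pi_ne_zero
  have harg : (Real.pi * (n * (z.arg / Real.pi) : ℝ) / n * Complex.I : ℂ) = z.arg * Complex.I := by
    push_cast
    field_simp
  rw [spoke, harg, Complex.norm_mul_exp_arg_mul_I]

theorem spoke_neg (n : ℕ) (r x : ℝ) : spoke n r (-x) = starRingEnd ℂ (spoke n r x) := by
  rw [spoke, spoke, map_mul, ← Complex.exp_conj]
  simp [neg_div]

theorem spoke_one_eq (r x : ℝ) : spoke 1 r x =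
    ⟨r * ((-1) ^ ⌊x⌋ * Real.cos (Int.fract x * Real.pi)),
      r * ((-1) ^ ⌊x⌋ * Real.sin (Int.fract x * Real.pi))⟩ := by
  have harg : (Real.pi * x / (1 : ℕ) * Complex.I : ℂ) =
      (Int.fract x * Real.pi + ⌊x⌋ * Real.pi : ℝ) * Complex.I := by
    rw [← add_mul, Int.fract_add_floor]
    push_cast
    ring
  rw [← Real.cos_add_int_mul_pi, ← Real.sin_add_int_mul_pi, spoke, harg]
  apply Complex.ext
  · rw [Complex.re_ofReal_mul, Complex.exp_ofReal_mul_I_re]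
  · rw [Complex.im_ofReal_mul, Complex.exp_ofReal_mul_I_im]

theorem sin_fract_mul_pi_nonneg (x : ℝ) : 0 ≤ Real.sin (Int.fract x * Real.pi) :=
  Real.sin_nonneg_of_nonneg_of_le_pi (mul_nonneg (Int.fract_nonneg x) Real.pi_pos.le)
    (mul_le_of_le_one_left Real.pi_pos.le (Int.fract_lt_one x).le)

theorem im_spoke_nonneg {r x : ℝ} (hr : 0 ≤ r) (hx : Even ⌊x⌋) : 0 ≤ (spoke 1 r x).im := by
  simp only [spoke_one_eq, hx.neg_one_zpow, one_mul]
  exact mul_nonneg hr (sin_fract_mul_pi_nonneg x)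

theorem im_spoke_nonpos {r x : ℝ} (hr : 0 ≤ r) (hx : Odd ⌊x⌋) : (spoke 1 r x).im ≤ 0 := by
  simp only [spoke_one_eq, hx.neg_one_zpow, neg_one_mul]
  exact mul_nonpos_of_nonneg_of_nonpos hr (neg_nonpos.2 (sin_fract_mul_pi_nonneg x))

theorem spoke_intCast (r : ℝ) (m : ℤ) : spoke 1 r m = (r * (-1) ^ m : ℝ) := by
  rw [spoke_one_eq]
  apply Complex.ext
  · rw [Complex.ofReal_re]
    simp
  · rw [Complex.ofReal_im]
    simp

theorem exists_spoke_one_eq {v : ℂ} (hv : 0 ≤ v.im) (k : ℤ) :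
    ∃ x ∈ Icc (k : ℝ) (k + 1), fold (spoke 1 ‖v‖ x) = v := by
  have hspoke : ∀ m : ℤ, spoke 1 ‖v‖ (v.arg / Real.pi + 2 * m) = v := fun m => by
    simpa using (spoke_add_two_mul_mul one_pos ‖v‖ _ m).trans (spoke_arg one_pos v)
  have h0 : 0 ≤ v.arg / Real.pi := div_nonneg (Complex.arg_nonneg_iff.2 hv) Real.pi_pos.le
  have h1 : v.arg / Real.pi ≤ 1 := div_le_one_of_le₀ (Complex.arg_le_pi v) Real.pi_pos.le
  rcases Int.even_or_odd' k with ⟨m, rfl | rfl⟩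
  · refine ⟨v.arg / Real.pi + 2 * m, ⟨?_, ?_⟩, by rw [hspoke, fold_of_im_nonneg hv]⟩ <;>
      push_cast <;> linarith
  · refine ⟨-(v.arg / Real.pi + 2 * (-(m + 1) : ℤ)), ⟨?_, ?_⟩, ?_⟩
    · push_cast
      linarith
    · push_cast
      linarith
    · rw [spoke_neg, hspoke, fold_of_im_nonpos (neg_nonpos.2 hv), Complex.conj_conj]

variable {E : Type} {a : ZMod 3 → Equiv.Perm E} (α : Aperture) (i : ZMod 3) (e : E)

theorem mk_gallery_sub_one {ρ : ℝ} (hρ : ρ ∈ Icc 0 1) (m : ℤ) :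
    mk (mirrorSwap a) side (gallery a i e (m - 1)) (foldPoint α i (spoke 1 ρ m)) =
      mk (mirrorSwap a) side (gallery a i e m) (foldPoint α i (spoke 1 ρ m)) := by
  have hnorm : ‖spoke 1 ρ m‖ ≤ 1 := (norm_spoke 1 hρ.1 m).trans_le hρ.2
  have him : (spoke 1 ρ m).im = 0 := by rw [spoke_intCast, Complex.ofReal_im]
  have hre : (spoke 1 ρ m).re = ρ * (-1) ^ m := by rw [spoke_intCast, Complex.ofReal_re]
  rcases Int.even_or_odd' m with ⟨j, rfl | rfl⟩
  · rw [← mirrorSwap_gallery_two_mul_sub_one]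
    refine (mk_apply_eq (foldPoint_mem_side_add_two hnorm him ?_)).symm
    rw [hre, (even_two_mul j).neg_one_zpow]
    linarith [hρ.1]
  · rw [add_sub_cancel_right, ← mirrorSwap_gallery_two_mul]
    refine (mk_apply_eq (foldPoint_mem_side_add_one hnorm him ?_)).symm
    rw [hre, (odd_two_mul_add_one j).neg_one_zpow]
    linarith [hρ.1]

theorem mk_gallery_corner (m : ℤ) :
    mk (mirrorSwap a) side (gallery a i e m) (foldPoint α i 0) =
      mk (mirrorSwap a) side (gallery a i e 0) (foldPoint α i 0) := by
  have hzero : ∀ m : ℤ, spoke 1 0 m = 0 := fun m => by simp [spoke]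
  have hstep : ∀ m : ℤ, mk (mirrorSwap a) side (gallery a i e (m - 1)) (foldPoint α i 0) =
      mk (mirrorSwap a) side (gallery a i e m) (foldPoint α i 0) := fun m => by
    simpa only [hzero] using mk_gallery_sub_one α i e ⟨le_rfl, zero_le_one⟩ m
  induction m with
  | zero => rfl
  | succ m ih => rw [← hstep, add_sub_cancel_right, ih]
  | pred m ih => rw [hstep, ih]

theorem mk_gallery_floor {ρ x : ℝ} (hρ : ρ ∈ Icc 0 1) {k : ℤ} (hk : x ∈ Icc (k : ℝ) (k + 1)) :
    mk (mirrorSwap a) side (gallery a i e k) (foldPoint α i (spoke 1 ρ x)) =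
      mk (mirrorSwap a) side (gallery a i e ⌊x⌋) (foldPoint α i (spoke 1 ρ x)) := by
  rcases hk.2.lt_or_eq with hlt | rfl
  · rw [Int.floor_eq_iff.2 ⟨hk.1, hlt⟩]
  · have h := mk_gallery_sub_one (a := a) α i e hρ (k + 1)
    push_cast at h
    rw [← Int.cast_one, ← Int.cast_add, Int.floor_intCast]
    push_cast
    rwa [add_sub_cancel_right] at h

variable {α i}

theorem eq_of_foldPoint_mem_side {v : ℂ} (hv : ‖v‖ < 1) (hv0 : v ≠ 0) {j j' : ZMod 3}
    (hj : foldPoint α i v ∈ side j) (hj' : foldPoint α i v ∈ side j') : j = j' := by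
  have hcases : ∀ j, foldPoint α i v ∈ side j → j = i + 1 ∧ v.re ≤ 0 ∨ j = i + 2 ∧ 0 ≤ v.re := by
    intro j hj
    have hne : j ≠ i := by
      rintro rfl
      exact foldPoint_notMem_side _ hv hj
    rcases eq_add_one_or_eq_add_two hne with rfl | rfl
    · exact .inl ⟨rfl, re_nonpos_of_foldPoint_mem_side hv hj⟩
    · exact .inr ⟨rfl, re_nonneg_of_foldPoint_mem_side hv hj⟩
  have him := im_eq_zero_of_foldPoint_mem_side hj
  have hre : v.re ≠ 0 := fun h => hv0 (Complex.ext h him)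
  rcases hcases j hj with ⟨rfl, h⟩ | ⟨rfl, h⟩ <;> rcases hcases j' hj' with ⟨rfl, h'⟩ | ⟨rfl, h'⟩
  exacts [rfl, absurd (le_antisymm h h') hre, absurd (le_antisymm h' h) hre, rfl]

theorem eq_of_mk_eq_mk {τ τ' : E × Bool} {z : Triangle}
    (h : mk (mirrorSwap a) side τ z = mk (mirrorSwap a) side τ' z) (hcol : τ.2 = τ'.2)
    (hz : ∀ j j', z ∈ side j → z ∈ side j' → j = j') : τ = τ' := by
  obtain ⟨-, g, hg, rfl⟩ := mk_eq_mk_iff.1 h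
  by_cases hside : ∃ j, z ∈ side j
  · obtain ⟨j, hj⟩ := hside
    have hs : ∀ j', z ∈ side j' → ∀ σ, mirrorSwap a j' σ ∈ ({τ, mirrorSwap a j τ} : Set _) ↔
        σ ∈ ({τ, mirrorSwap a j τ} : Set _) := by
      intro j' hj' σ
      rw [← hz j j' hj hj', mem_insert_iff, mem_singleton_iff, mem_insert_iff, mem_singleton_iff,
        EmbeddingLike.apply_eq_iff_eq, or_comm, ← (mirrorSwap a j).apply_eq_iff_eq (y := τ),
        (mirrorSwap a j).apply_eq_iff_eq, ← Equiv.eq_symm_apply]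
      rfl
    rcases (apply_mem_iff_of_mem_mirrorGroup hs hg τ).2 (mem_insert _ _) with h | h
    · exact h.symm
    · rw [mem_singleton_iff.1 h, mirrorSwap_snd] at hcol
      simp at hcol
  · exact (apply_eq_of_mem_mirrorGroup (not_exists.1 hside) hg τ).symm

theorem spoke_one_eq_of_mk_gallery_eq {ρ x x' : ℝ} (hρ : ρ ∈ Ioo 0 1)
    (h : mk (mirrorSwap a) side (gallery a i e ⌊x⌋) (foldPoint α i (spoke 1 ρ x)) =
      mk (mirrorSwap a) side (gallery a i e ⌊x'⌋) (foldPoint α i (spoke 1 ρ x'))) :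
    spoke 1 ρ x = spoke 1 ρ x' := by
  obtain ⟨hz, g, hg, hgal⟩ := mk_eq_mk_iff.1 h
  have hfold := (foldPoint_eq_foldPoint_iff α i).1 hz
  by_cases him : (spoke 1 ρ x).im = 0
  · have him' : (spoke 1 ρ x').im = 0 := by
      simpa [fold, him] using (congrArg Complex.im hfold).symm
    rwa [fold_of_im_nonneg him.ge, fold_of_im_nonneg him'.ge] at hfold
  · rw [apply_eq_of_mem_mirrorGroup (fun j hj => him (im_eq_zero_of_foldPoint_mem_side hj)) hg]
      at hgal
    have hparity : Even ⌊x⌋ ↔ Even ⌊x'⌋ := by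
      rw [← decide_eq_decide, ← gallery_snd (a := a) (i := i) (e := e), hgal, gallery_snd]
    rcases Int.even_or_odd ⌊x⌋ with hx | hx
    · rwa [fold_of_im_nonneg (im_spoke_nonneg hρ.1.le hx),
        fold_of_im_nonneg (im_spoke_nonneg hρ.1.le (hparity.1 hx))] at hfold
    · have hx' : Odd ⌊x'⌋ := by rwa [← Int.not_even_iff_odd, ← hparity, Int.not_even_iff_odd]
      rw [fold_of_im_nonpos (im_spoke_nonpos hρ.1.le hx),
        fold_of_im_nonpos (im_spoke_nonpos hρ.1.le hx')] at hfold
      exact (starRingEnd ℂ).injective hfold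

/-- A space of parameters for the disc with `2 * n` sectors: the number of the sector, the radius
and the angle, in units of `π / n`, from the initial ray of the sector. -/
abbrev Wheel (n : ℕ) : Type := Fin (2 * n) × unitInterval × unitInterval

/-- The point of the disc with parameters `w`. -/
noncomputable def wheelCoord {n : ℕ} (w : Wheel n) : ℂ :=
  spoke n w.2.1 ((w.1 : ℕ) + w.2.2)

theorem norm_wheelCoord {n : ℕ} (w : Wheel n) : ‖wheelCoord w‖ = w.2.1 :=
  norm_spoke n w.2.1.2.1 _

theorem continuous_wheelCoord (n : ℕ) : Continuous (wheelCoord : Wheel n → ℂ) := by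
  unfold wheelCoord spoke
  fun_prop

variable (a α i)

/-- The point with parameters `w` of the disc around the corner `i` of the chamber `e`. -/
noncomputable def wheelPoint (w : Wheel (valency a i e)) : TriangulatedSurface a :=
  mk (mirrorSwap a) side (gallery a i e (w.1 : ℕ)) (foldPoint α i (wheelCoord w ^ valency a i e))

theorem continuous_wheelPoint : Continuous (wheelPoint a α i e) :=
  continuous_prod_of_discrete_left.2 fun k => by
    have hpow : Continuous fun x => wheelCoord (k, x) ^ valency a i e :=
      ((continuous_wheelCoord _).comp (Continuous.prodMk_right k)).pow _
    exact (continuous_mk (p := mirrorSwap a) (gallery a i e (k : ℕ))).comp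
      ((continuous_foldPoint α i).comp hpow)

variable {a α i e}

instance : T2Space (TriangulatedSurface a) := t2Space isClosed_side

variable (a α i e)

/-- The open disc around the corner `i` of the chamber `e`, of the shape given by `α`. -/
def disc : Set (TriangulatedSurface a) :=
  chambersOver (mirrorSwap a) side (range (gallery a i e)) {z | excess α i z < 0}

variable {a α i e}

theorem mem_disc_iff {q : TriangulatedSurface a} : q ∈ disc a α i e ↔
    (∃ k z, mk (mirrorSwap a) side (gallery a i e k) z = q) ∧ excess α i (toBase q) < 0 := by
  simp only [disc, chambersOver, mem_iUnion, exists_prop, exists_range_iff]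
  constructor
  · rintro ⟨k, z, hz, rfl⟩
    exact ⟨⟨k, z, rfl⟩, hz⟩
  · rintro ⟨⟨k, z, rfl⟩, hz⟩
    exact ⟨k, z, hz, rfl⟩

theorem mirrorSwap_mem_range_gallery_iff_of_excess_neg (j : ZMod 3)
    (hj : ({z | excess α i z < 0} ∩ side j).Nonempty) (τ : E × Bool) :
    mirrorSwap a j τ ∈ range (gallery a i e) ↔ τ ∈ range (gallery a i e) := by
  refine mirrorSwap_mem_range_gallery_iff ?_ τ
  rintro rfl
  obtain ⟨z, hz, hzj⟩ := hj
  obtain ⟨v, -, rfl⟩ := exists_foldPoint_eq α j (le_of_lt hz)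
  exact foldPoint_notMem_side j ((excess_foldPoint_neg_iff α j v).1 hz) hzj

theorem mk_mem_disc_iff {τ : E × Bool} {z : Triangle} :
    mk (mirrorSwap a) side τ z ∈ disc a α i e ↔ τ ∈ range (gallery a i e) ∧ excess α i z < 0 :=
  mk_mem_chambersOver_iff mirrorSwap_mem_range_gallery_iff_of_excess_neg

theorem isOpen_disc : IsOpen (disc a α i e) :=
  isOpen_chambersOver (isOpen_lt (continuous_excess α i) continuous_const)
    mirrorSwap_mem_range_gallery_iff_of_excess_neg

variable [Finite E]

theorem mk_gallery_eq_of_spoke_eq {r x x' : ℝ} (hr : 0 ≤ r)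
    (h : spoke (valency a i e) r x = spoke (valency a i e) r x') :
    mk (mirrorSwap a) side (gallery a i e ⌊x⌋)
        (foldPoint α i (spoke (valency a i e) r x ^ valency a i e)) =
      mk (mirrorSwap a) side (gallery a i e ⌊x'⌋)
        (foldPoint α i (spoke (valency a i e) r x' ^ valency a i e)) := by
  have hn : 0 < valency a i e := valency_pos
  rcases hr.eq_or_lt with rfl | hr
  · have hzero : ∀ x : ℝ, spoke (valency a i e) 0 x ^ valency a i e = 0 := fun x => by
      simp [spoke, hn.ne']
    rw [hzero, hzero, mk_gallery_corner, mk_gallery_corner α i e ⌊x'⌋]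
  · obtain ⟨q, hq⟩ := (spoke_eq_spoke_iff hn hr x x').1 h
    have hfloor : ⌊x⌋ - ⌊x'⌋ = (2 * valency a i e : ℕ) * q := by
      have hx : x = x' + ((2 * valency a i e : ℕ) * q : ℤ) := by
        push_cast
        linarith
      rw [hx, Int.floor_add_intCast]
      ring
    rw [h, gallery_eq_gallery_iff.2 ⟨q, hfloor⟩]

theorem spoke_eq_of_mk_gallery_eq {r r' x x' : ℝ} (hr : r ∈ Ico 0 1) (hr' : 0 ≤ r')
    (h : mk (mirrorSwap a) side (gallery a i e ⌊x⌋)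
        (foldPoint α i (spoke (valency a i e) r x ^ valency a i e)) =
      mk (mirrorSwap a) side (gallery a i e ⌊x'⌋)
        (foldPoint α i (spoke (valency a i e) r' x' ^ valency a i e))) :
    spoke (valency a i e) r x = spoke (valency a i e) r' x' := by
  have hn : 0 < valency a i e := valency_pos
  obtain rfl : r = r' := by
    have hnorm := congrArg norm ((foldPoint_eq_foldPoint_iff α i).1 (mk_eq_mk_iff.1 h).1)
    rw [norm_fold, norm_fold, norm_pow, norm_pow, norm_spoke _ hr.1, norm_spoke _ hr'] at hnorm
    exact (pow_left_inj₀ hr.1 hr' hn.ne').1 hnorm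
  rcases hr.1.eq_or_lt with rfl | hpos
  · simp [spoke]
  rw [spoke_pow hn, spoke_pow hn] at h
  set ρ := r ^ valency a i e
  have hρ : ρ ∈ Ioo 0 1 := ⟨pow_pos hpos _, pow_lt_one₀ hr.1 hr.2 hn.ne'⟩
  have hV := spoke_one_eq_of_mk_gallery_eq e hρ h
  obtain ⟨q, hq⟩ := (spoke_eq_spoke_iff one_pos hρ.1 x x').1 hV
  have hfloor : ⌊x⌋ - ⌊x'⌋ = 2 * q := by
    rw [show x = x' + (2 * q : ℤ) by push_cast; push_cast at hq; linarith, Int.floor_add_intCast]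
    ring
  have hne : spoke 1 ρ x ≠ 0 := by
    rw [← norm_pos_iff, norm_spoke 1 hρ.1.le]
    exact hρ.1
  have hgal : gallery a i e ⌊x⌋ = gallery a i e ⌊x'⌋ := by
    rw [← hV] at h
    refine eq_of_mk_eq_mk h ?_ fun j j' => eq_of_foldPoint_mem_side
      ((norm_spoke 1 hρ.1.le x).trans_lt hρ.2) hne
    rw [gallery_snd, gallery_snd, decide_eq_decide, ← Int.even_sub, hfloor]
    exact even_two_mul q
  obtain ⟨q', hq'⟩ := gallery_eq_gallery_iff.1 hgal
  refine (spoke_eq_spoke_iff hn hpos x x').2 ⟨q', ?_⟩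
  have hint : 2 * q = 2 * valency a i e * q' := by
    rw [← hfloor, hq']
    push_cast
    rfl
  push_cast at hq
  rw [hq, mul_one]
  exact_mod_cast hint

theorem wheelPoint_eq (w : Wheel (valency a i e)) : wheelPoint a α i e w =
    mk (mirrorSwap a) side (gallery a i e ⌊((w.1 : ℕ) + w.2.2 : ℝ)⌋)
      (foldPoint α i (wheelCoord w ^ valency a i e)) := by
  have h := w.2.2.2
  rw [wheelPoint, wheelCoord, spoke_pow valency_pos]
  refine mk_gallery_floor α i e ⟨pow_nonneg w.2.1.2.1 _, pow_le_one₀ w.2.1.2.1 w.2.1.2.2⟩ ?_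
  push_cast
  exact ⟨by linarith [h.1], by linarith [h.2]⟩

theorem wheelPoint_eq_wheelPoint_iff {w : Wheel (valency a i e)} (hw : wheelCoord w ∈ ball 0 1)
    (w' : Wheel (valency a i e)) :
    wheelPoint a α i e w = wheelPoint a α i e w' ↔ wheelCoord w = wheelCoord w' := by
  rw [wheelPoint_eq, wheelPoint_eq]
  rw [mem_ball_zero_iff, norm_wheelCoord] at hw
  refine ⟨spoke_eq_of_mk_gallery_eq ⟨w.2.1.2.1, hw⟩ w'.2.1.2.1, fun h => ?_⟩
  have hr : (w.2.1 : ℝ) = w'.2.1 := by rw [← norm_wheelCoord, h, norm_wheelCoord]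
  unfold wheelCoord at h ⊢
  rw [← hr] at h ⊢
  exact mk_gallery_eq_of_spoke_eq w.2.1.2.1 h

variable (a i e) in
theorem exists_wheelCoord_eq {r : ℝ} (hr : r ∈ Icc 0 1) (x : ℝ) :
    ∃ w : Wheel (valency a i e), wheelCoord w = spoke (valency a i e) r x ∧
      gallery a i e (w.1 : ℕ) = gallery a i e ⌊x⌋ := by
  have hn : 0 < ((2 * valency a i e : ℕ) : ℤ) :=
    Int.natCast_pos.2 (Nat.mul_pos two_pos valency_pos)
  set n := valency a i e
  obtain ⟨k, hk⟩ := Int.eq_ofNat_of_zero_le (Int.emod_nonneg ⌊x⌋ hn.ne')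
  have hkn : k < 2 * n := by exact_mod_cast hk ▸ Int.emod_lt_of_pos ⌊x⌋ hn
  have hx : (k : ℤ) - ⌊x⌋ = ((2 * n : ℕ) : ℤ) * -(⌊x⌋ / (2 * n : ℕ)) := by
    linear_combination Int.emod_add_mul_ediv ⌊x⌋ (2 * n : ℕ) - hk
  refine ⟨(⟨k, hkn⟩, ⟨r, hr⟩, ⟨Int.fract x, Int.fract_nonneg x, (Int.fract_lt_one x).le⟩), ?_,
    gallery_eq_gallery_iff.2 ⟨_, hx⟩⟩
  have hx' : (k : ℝ) - ⌊x⌋ = 2 * n * (-(⌊x⌋ / (2 * n : ℕ)) : ℤ) := by exact_mod_cast hx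
  have harg : (k : ℝ) + Int.fract x = x + 2 * n * (-(⌊x⌋ / (2 * n : ℕ)) : ℤ) := by
    linarith [Int.fract_add_floor x]
  change spoke n r (k + Int.fract x) = spoke n r x
  rw [harg, spoke_add_two_mul_mul valency_pos]

theorem ball_subset_range_wheelCoord :
    ball 0 1 ⊆ range (wheelCoord : Wheel (valency a i e) → ℂ) := by
  intro z hz
  obtain ⟨w, hw, -⟩ := exists_wheelCoord_eq a i e
    ⟨norm_nonneg z, (mem_ball_zero_iff.1 hz).le⟩ (valency a i e * (z.arg / Real.pi))
  exact ⟨w, hw.trans (spoke_arg valency_pos z)⟩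

theorem excess_toBase_wheelPoint_neg_iff (w : Wheel (valency a i e)) :
    excess α i (toBase (wheelPoint a α i e w)) < 0 ↔ wheelCoord w ∈ ball 0 1 := by
  rw [wheelPoint, toBase_mk, excess_foldPoint_neg_iff, mem_ball_zero_iff, norm_pow,
    pow_lt_one_iff_of_nonneg (norm_nonneg _) valency_pos.ne']

variable (a e) in
theorem exists_wheelPoint_eq (k : ℤ) {z : Triangle} (hz : excess α i z ≤ 0) :
    ∃ w, wheelPoint a α i e w = mk (mirrorSwap a) side (gallery a i e k) z := by
  obtain ⟨v, hv, rfl⟩ := exists_foldPoint_eq α i hz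
  obtain ⟨x, hx, hxv⟩ := exists_spoke_one_eq hv k
  have hn : valency a i e ≠ 0 := valency_pos.ne'
  have hv1 : ‖v‖ ≤ 1 := by
    rcases hz.lt_or_eq with h | h
    · exact ((excess_foldPoint_neg_iff α i v).1 h).le
    · exact ((excess_foldPoint_eq_zero_iff α i v).1 h).le
  have hpow : (‖v‖ ^ (valency a i e : ℝ)⁻¹) ^ valency a i e = ‖v‖ :=
    Real.rpow_inv_natCast_pow (norm_nonneg v) hn
  obtain ⟨w, hw, hwk⟩ := exists_wheelCoord_eq a i e
    ⟨Real.rpow_nonneg (norm_nonneg v) (valency a i e : ℝ)⁻¹,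
      Real.rpow_le_one (norm_nonneg v) hv1 (by positivity)⟩ x
  refine ⟨w, ?_⟩
  have hfold : foldPoint α i (spoke 1 ‖v‖ x) = foldPoint α i v := by
    rw [foldPoint_eq_foldPoint_iff, hxv, fold_of_im_nonneg hv]
  rw [wheelPoint, hw, hwk, spoke_pow valency_pos, hpow,
    ← mk_gallery_floor α i e ⟨norm_nonneg v, hv1⟩ hx, hfold]

theorem image_wheelPoint_ball :
    wheelPoint a α i e '' (wheelCoord ⁻¹' ball 0 1) = disc a α i e := by
  ext q
  rw [mem_disc_iff]
  constructor
  · rintro ⟨w, hw, rfl⟩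
    exact ⟨⟨_, _, rfl⟩, (excess_toBase_wheelPoint_neg_iff w).2 hw⟩
  · rintro ⟨⟨k, z, rfl⟩, hz⟩
    obtain ⟨w, hw⟩ := exists_wheelPoint_eq a e k hz.le
    exact ⟨w, (excess_toBase_wheelPoint_neg_iff w).1 (hw ▸ hz), hw⟩

theorem exists_disc_chart : ∃ c : OpenPartialHomeomorph (TriangulatedSurface a) ℂ,
    c.source = disc a α i e ∧ c.target = ball 0 1 ∧
      ∀ w : Wheel (valency a i e), wheelCoord w ∈ ball 0 1 →
        c (wheelPoint a α i e w) = wheelCoord w := by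
  have : Nonempty (Wheel (valency a i e)) :=
    ⟨⟨0, Nat.mul_pos two_pos valency_pos⟩, 0, 0⟩
  rw [← image_wheelPoint_ball]
  exact exists_openPartialHomeomorph_of_comp_eq (continuous_wheelPoint a α i e)
    (continuous_wheelCoord _) isOpen_ball ball_subset_range_wheelCoord
    (fun _ => wheelPoint_eq_wheelPoint_iff) (by rw [image_wheelPoint_ball]; exact isOpen_disc)

variable (a α i e)

/-- The chart of the disc around a corner in which the chambers are the sectors of the unit disc. -/
noncomputable def discChart : OpenPartialHomeomorph (TriangulatedSurface a) ℂ :=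
  (exists_disc_chart (α := α) (a := a) (i := i) (e := e)).choose

theorem discChart_source : (discChart a α i e).source = disc a α i e :=
  exists_disc_chart.choose_spec.1

theorem discChart_target : (discChart a α i e).target = ball 0 1 :=
  exists_disc_chart.choose_spec.2.1

variable {a α i e}

theorem discChart_wheelPoint {w : Wheel (valency a i e)} (hw : wheelCoord w ∈ ball 0 1) :
    discChart a α i e (wheelPoint a α i e w) = wheelCoord w :=
  exists_disc_chart.choose_spec.2.2 w hw

theorem exists_eq_mk_discChart {q : TriangulatedSurface a} (hq : q ∈ disc a α i e) :
    ∃ k : ℤ, q = mk (mirrorSwap a) side (gallery a i e k)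
        (foldPoint α i (discChart a α i e q ^ valency a i e)) ∧
      (Even k → 0 ≤ (discChart a α i e q ^ valency a i e).im) ∧
      (Odd k → (discChart a α i e q ^ valency a i e).im ≤ 0) := by
  rw [← image_wheelPoint_ball] at hq
  obtain ⟨w, hw, rfl⟩ := hq
  have hr : 0 ≤ (w.2.1 : ℝ) ^ valency a i e := pow_nonneg w.2.1.2.1 _
  rw [discChart_wheelPoint hw]
  refine ⟨⌊((w.1 : ℕ) + w.2.2 : ℝ)⌋, wheelPoint_eq w, fun h => ?_, fun h => ?_⟩ <;>
    rw [wheelCoord, spoke_pow valency_pos]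
  exacts [im_spoke_nonneg hr h, im_spoke_nonpos hr h]

end Wheel

section Orientation

theorem det_restrictScalars_toSpanSingleton (a : ℂ) :
    ((ContinuousLinearMap.toSpanSingleton ℂ a).restrictScalars ℝ).det = Complex.normSq a := by
  have hmul : (((ContinuousLinearMap.toSpanSingleton ℂ a).restrictScalars ℝ : ℂ →L[ℝ] ℂ) :
      ℂ →ₗ[ℝ] ℂ) = LinearMap.mul ℝ ℂ a := by
    ext
    simp [mul_comm]
  rw [ContinuousLinearMap.det, hmul, ← Algebra.norm_complex_apply, Algebra.norm_apply]
  rfl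

open scoped ContDiff in
theorem contDiffOn_det_pos_of_comp_eq (T : OpenPartialHomeomorph ℂ ℂ) {F F' : ℂ → ℂ}
    (hF : ∀ w ∈ T.source, ∃ a ≠ 0, HasStrictDerivAt F a w)
    (hF' : ∀ w ∈ T.source, ∃ a ≠ 0, HasStrictDerivAt F' a (T w))
    (hc : ∀ w ∈ T.source, F' (T w) = F w) :
    ContDiffOn ℝ ∞ T T.source ∧ ∀ z ∈ T.source, 0 < (fderiv ℝ T z).det := by
  have hderiv : ∀ w ∈ T.source, ∃ a ≠ 0, HasDerivAt T a w := by
    intro w hw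
    obtain ⟨a, ha, hFa⟩ := hF w hw
    obtain ⟨b, hb, hFb⟩ := hF' w hw
    have hcont : ContinuousAt T w := T.continuousAt hw
    have hev := hcont.eventually (hFb.eventually_left_inverse hb)
    have hsrc := T.open_source.mem_nhds hw
    have hinv := (hFb.to_localInverse hb).hasDerivAt
    rw [hc w hw] at hinv
    refine ⟨b⁻¹ * a, mul_ne_zero (inv_ne_zero hb) ha, ?_⟩
    refine (hinv.comp w hFa.hasDerivAt).congr_of_eventuallyEq ?_
    filter_upwards [hev, hsrc] with z hz hzs
    rw [Function.comp_apply, ← hc z hzs, hz]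
  constructor
  · have hd : DifferentiableOn ℂ T T.source := fun w hw => by
      obtain ⟨a, -, h⟩ := hderiv w hw
      exact h.differentiableAt.differentiableWithinAt
    exact (hd.contDiffOn T.open_source).restrict_scalars ℝ
  · intro z hz
    obtain ⟨a, ha, h⟩ := hderiv z hz
    rw [(h.hasFDerivAt.restrictScalars ℝ).fderiv, det_restrictScalars_toSpanSingleton]
    exact Complex.normSq_pos.2 ha

open scoped ContDiff in
theorem contDiffOn_det_pos_symm_trans_self {S : Type*} [TopologicalSpace S]
    (c : OpenPartialHomeomorph S ℂ) :
    ContDiffOn ℝ ∞ (c.symm.trans c) (c.symm.trans c).source ∧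
      ∀ z ∈ (c.symm.trans c).source, 0 < (fderiv ℝ (c.symm.trans c) z).det := by
  refine contDiffOn_det_pos_of_comp_eq _ (F := id) (F' := id) ?_ ?_ ?_
  · exact fun w _ => ⟨1, one_ne_zero, hasStrictDerivAt_id _⟩
  · exact fun w _ => ⟨1, one_ne_zero, hasStrictDerivAt_id _⟩
  · intro w hw
    rw [OpenPartialHomeomorph.trans_source] at hw
    exact c.right_inv hw.1

end Orientation

section Atlas

open BasicConstruction ComplexConjugate

variable {E : Type} {a : ZMod 3 → Equiv.Perm E} {i j : ZMod 3} {e e' : E}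

theorem foldPoint_zero (α : Aperture) (i : ZMod 3) : (foldPoint α i 0 : ℂ) = corner i := by
  have hfold : fold 0 = 0 := norm_eq_zero.1 (by rw [norm_fold, norm_zero])
  simp [foldPoint, foldMap, hfold]

theorem gallery_zpow_apply (m : ℤ) (k : ℤ) :
    gallery a i ((rotation a i ^ m) e) k = gallery a i e (k + 2 * m) := by
  rcases Int.even_or_odd' k with ⟨l, rfl | rfl⟩
  · rw [← mul_add, gallery_two_mul, gallery_two_mul, zpow_add]
    rfl
  · rw [show 2 * l + 1 + 2 * m = 2 * (l + m) + 1 by ring, gallery_two_mul_add_one,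
      gallery_two_mul_add_one, zpow_add]
    rfl

theorem range_gallery_eq (h : (rotation a i).SameCycle e e') :
    range (gallery a i e) = range (gallery a i e') := by
  obtain ⟨m, rfl⟩ := h
  rw [funext (gallery_zpow_apply m)]
  exact ((Equiv.addRight (2 * m)).surjective.range_comp (gallery a i e)).symm

theorem disc_eq_disc {α : Aperture} (h : (rotation a i).SameCycle e e') :
    disc a α i e = disc a α i e' := by
  rw [disc, range_gallery_eq h, disc]

theorem sameCycle_of_mem_range_gallery {τ : E × Bool} (h : τ ∈ range (gallery a i e))
    (h' : τ ∈ range (gallery a i e')) : (rotation a i).SameCycle e e' := by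
  rcases τ with ⟨b, _ | _⟩
  · have hne : i + 1 ≠ i := by simp
    rw [← mirrorSwap_mem_range_gallery_iff hne, mirrorSwap_false, mem_range_gallery_iff] at h h'
    exact h.trans h'.symm
  · exact (mem_range_gallery_iff.1 h).trans (mem_range_gallery_iff.1 h').symm

theorem sameCycle_of_mem_disc {α : Aperture} {q : TriangulatedSurface a} (h : q ∈ disc a α i e)
    (h' : q ∈ disc a α i e') : (rotation a i).SameCycle e e' := by
  obtain ⟨τ, z, rfl⟩ := exists_mk_eq q
  exact sameCycle_of_mem_range_gallery (mk_mem_disc_iff.1 h).1 (mk_mem_disc_iff.1 h').1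

theorem exists_mem_range_gallery (a : ZMod 3 → Equiv.Perm E) (i : ZMod 3) :
    ∀ τ : E × Bool, ∃ e, τ ∈ range (gallery a i e)
  | (e, true) => ⟨e, 0, gallery_zero⟩
  | (e, false) => ⟨(a (i + 1))⁻¹ e, 2 * 0 + 1, by rw [gallery_two_mul_add_one]; simp⟩

theorem fold_eq_or_fold_eq_conj_discChart [Finite E] {α : Aperture} {q : TriangulatedSurface a}
    (hq : q ∈ disc a α i e) (hq' : q ∈ disc a α j e') {V V' : ℂ}
    (hV : discChart a α i e q ^ valency a i e = V)
    (hV' : discChart a α j e' q ^ valency a j e' = V') :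
    foldPoint α i V = foldPoint α j V' ∧
      (fold V = V ∧ fold V' = V' ∨ fold V = conj V ∧ fold V' = conj V') := by
  obtain ⟨k, hk, heven, hodd⟩ := exists_eq_mk_discChart hq
  obtain ⟨k', hk', heven', hodd'⟩ := exists_eq_mk_discChart hq'
  rw [hV] at hk heven hodd
  rw [hV'] at hk' heven' hodd'
  obtain ⟨hz, g, hg, hgal⟩ := mk_eq_mk_iff.1 (hk.symm.trans hk')
  refine ⟨hz, ?_⟩
  by_cases hside : ∃ l, foldPoint α i V ∈ side l
  · obtain ⟨l, hl⟩ := hside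
    exact .inl ⟨fold_of_im_nonneg (im_eq_zero_of_foldPoint_mem_side hl).ge,
      fold_of_im_nonneg (im_eq_zero_of_foldPoint_mem_side (hz ▸ hl)).ge⟩
  · rw [apply_eq_of_mem_mirrorGroup (not_exists.1 hside) hg] at hgal
    have hparity : Even k ↔ Even k' := by
      rw [← decide_eq_decide, ← gallery_snd (a := a) (i := i) (e := e), hgal, gallery_snd]
    rcases Int.even_or_odd k with hk | hk
    · exact .inl ⟨fold_of_im_nonneg (heven hk), fold_of_im_nonneg (heven' (hparity.1 hk))⟩
    · exact .inr ⟨fold_of_im_nonpos (hodd hk), fold_of_im_nonpos (hodd'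
        (Int.not_even_iff_odd.1 (mt hparity.2 (Int.not_even_iff_odd.2 hk))))⟩

theorem discChart_relation [Finite E] {α : Aperture} {q : TriangulatedSurface a}
    (hq : q ∈ disc a α i e) (hq' : q ∈ disc a α j e') {V V' : ℂ}
    (hV : discChart a α i e q ^ valency a i e = V)
    (hV' : discChart a α j e' q ^ valency a j e' = V') :
    corner i * (1 + α.val * V) * (1 + conj α.val * V') =
      corner j * (1 + α.val * V') * (1 + conj α.val * V) := by
  obtain ⟨hz, hside⟩ := fold_eq_or_fold_eq_conj_discChart hq hq' hV hV'
  have hfold : corner i * (1 + α.val * fold V) * (1 + conj α.val * fold V') =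
      corner j * (1 + α.val * fold V') * (1 + conj α.val * fold V) := by
    have h := congrArg (Subtype.val : Triangle → ℂ) hz
    change corner i * foldMap α V = corner j * foldMap α V' at h
    rw [← foldMap_mul, ← foldMap_mul]
    linear_combination (1 + conj α.val * fold V) * (1 + conj α.val * fold V') * h
  rcases hside with ⟨h, h'⟩ | ⟨h, h'⟩
  · rwa [h, h'] at hfold
  · rw [h, h'] at hfold
    have hconj := congrArg conj hfold
    simp only [map_mul, map_add, map_one, Complex.conj_conj, conj_corner] at hconj
    linear_combination -corner i * corner j * hconj +
      corner j * (1 + conj α.val * V) * (1 + α.val * V') * corner_neg_mul_corner i -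
      corner i * (1 + conj α.val * V') * (1 + α.val * V) * corner_neg_mul_corner j

/-- The aperture of the discs that form the atlas of the triangulated surface. -/
noncomputable def chartAperture : Aperture where
  val := √3 * Complex.I
  im_pos := by simp
  im_add_le := by simp

theorem re_corner_mul_conj_corner (h : i ≠ j) : (corner i * conj (corner j)).re = -1 / 2 := by
  have hcases : ∀ m : ZMod 3, m ≠ 0 → m = 1 ∨ m = 2 := by decide
  rw [conj_corner, ← corner_add, ← sub_eq_add_neg]
  rcases hcases _ (sub_ne_zero.2 h) with hm | hm
  · rw [hm, corner_one]
  · rw [hm, corner_two]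

theorem norm_corner_sub_corner (h : i ≠ j) :
    ‖corner i - corner j‖ = √3 * ‖corner i + corner j‖ := by
  refine (sq_eq_sq₀ (norm_nonneg _) (by positivity)).1 ?_
  rw [mul_pow, Real.sq_sqrt (by norm_num), Complex.sq_norm, Complex.sq_norm, Complex.normSq_sub,
    Complex.normSq_add, re_corner_mul_conj_corner h, ← Complex.sq_norm, ← Complex.sq_norm,
    norm_corner, norm_corner]
  norm_num

theorem excess_chartAperture (i : ZMod 3) (z : Triangle) :
    excess chartAperture i z = ‖(z : ℂ) - corner i‖ - √3 * ‖(z : ℂ) + corner i‖ := by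
  have hsub : corner (-i) * z - 1 = corner (-i) * (z - corner i) := by
    linear_combination corner_neg_mul_corner i
  have hadd : chartAperture.val - conj chartAperture.val * (corner (-i) * z) =
      √3 * Complex.I * (corner (-i) * (z + corner i)) := by
    simp only [chartAperture, map_mul, Complex.conj_ofReal, Complex.conj_I]
    linear_combination -√3 * Complex.I * corner_neg_mul_corner i
  rw [excess, hsub, hadd]
  simp [norm_corner, abs_of_nonneg]

theorem excess_chartAperture_foldPoint_zero (h : i ≠ j) (α : Aperture) :
    excess chartAperture j (foldPoint α i 0) = 0 := by
  rw [excess_chartAperture, foldPoint_zero, norm_corner_sub_corner h, sub_self]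

theorem exists_excess_chartAperture_neg (z : Triangle) : ∃ i, excess chartAperture i z < 0 := by
  by_contra! h
  have hre : ∀ i, (z * conj (corner i)).re ≤ -1 / 4 := fun i => by
    have hsq := pow_le_pow_left₀ (by positivity)
      (sub_nonneg.1 ((h i).trans_eq (excess_chartAperture i z))) 2
    rw [mul_pow, Real.sq_sqrt (by norm_num), Complex.sq_norm, Complex.sq_norm, Complex.normSq_sub,
      Complex.normSq_add, ← Complex.sq_norm (corner i), norm_corner] at hsq
    nlinarith [Complex.normSq_nonneg z]
  have hsum :
      (z * conj (corner 0)).re + (z * conj (corner 1)).re + (z * conj (corner 2)).re = 0 := by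
    rw [← Complex.add_re, ← Complex.add_re, ← mul_add, ← mul_add, ← map_add, ← map_add]
    have : corner 0 + corner 1 + corner 2 = 0 := by
      rw [corner_zero, corner_one, corner_two]
      exact Complex.ext (by norm_num) (by norm_num)
    rw [this, map_zero, mul_zero, Complex.zero_re]
  linarith [hre 0, hre 1, hre 2]

theorem exists_mem_disc (a : ZMod 3 → Equiv.Perm E) (q : TriangulatedSurface a) :
    ∃ i e, q ∈ disc a chartAperture i e := by
  obtain ⟨τ, z, rfl⟩ := exists_mk_eq q
  obtain ⟨i, hi⟩ := exists_excess_chartAperture_neg z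
  obtain ⟨e, he⟩ := exists_mem_range_gallery a i τ
  exact ⟨i, e, mk_mem_disc_iff.2 ⟨he, hi⟩⟩

theorem corner_mul_sub_corner_mul_ne_zero (h : i ≠ j) {V : ℂ} (hV : ‖V‖ < 1) :
    corner i * (1 + chartAperture.val * V) - corner j * (1 + conj chartAperture.val * V) ≠ 0 := by
  intro h0
  have heq : corner i - corner j = -(√3 * Complex.I * ((corner i + corner j) * V)) := by
    simp only [chartAperture, map_mul, Complex.conj_ofReal, Complex.conj_I] at h0
    linear_combination h0
  have hpos : 0 < ‖corner i - corner j‖ := norm_pos_iff.2 (sub_ne_zero.2 (corner_injective.ne h))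
  have hnorm : ‖corner i - corner j‖ = √3 * ‖corner i + corner j‖ * ‖V‖ := by
    rw [heq]
    simp [abs_of_nonneg, mul_assoc]
  rw [← norm_corner_sub_corner h] at hnorm
  nlinarith

section Transition

variable [Finite E]

theorem norm_discChart_pow_lt_one {α : Aperture} {q : TriangulatedSurface a}
    (hq : q ∈ disc a α i e) : ‖discChart a α i e q ^ valency a i e‖ < 1 := by
  rw [← discChart_source] at hq
  have h := (discChart a α i e).map_source hq
  rw [discChart_target, mem_ball_zero_iff] at h
  rw [norm_pow]
  exact pow_lt_one₀ (norm_nonneg _) h valency_pos.ne'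

theorem discChart_ne_zero (hij : i ≠ j) {q : TriangulatedSurface a}
    (hq : q ∈ disc a chartAperture i e) (hq' : q ∈ disc a chartAperture j e') :
    discChart a chartAperture i e q ≠ 0 := by
  intro h0
  obtain ⟨k, hk, -⟩ := exists_eq_mk_discChart hq
  rw [h0, zero_pow valency_pos.ne'] at hk
  have hneg := (mem_disc_iff.1 hq').2
  rw [hk, toBase_mk, excess_chartAperture_foldPoint_zero hij] at hneg
  exact lt_irrefl 0 hneg

/-- The coordinate `1 / (z - corner j)` of the model triangle, as a function of the argument `V` of
the folding map of the corner `i`. It has no pole in the discs around the corners other than `j`. -/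
noncomputable def poleCoord (i j : ZMod 3) (V : ℂ) : ℂ :=
  (1 + conj chartAperture.val * V) /
    (corner i * (1 + chartAperture.val * V) - corner j * (1 + conj chartAperture.val * V))

theorem exists_hasStrictDerivAt_poleCoord_pow (h : i ≠ j) {n : ℕ} (hn : 0 < n) {w : ℂ} (hw : w ≠ 0)
    (hV : ‖w ^ n‖ < 1) : ∃ d ≠ 0, HasStrictDerivAt (fun w => poleCoord i j (w ^ n)) d w := by
  have hden := corner_mul_sub_corner_mul_ne_zero h hV
  have hpow := hasStrictDerivAt_pow n w
  have hnum := (hpow.const_mul (conj chartAperture.val)).const_add 1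
  have hdiv := hnum.div ((((hpow.const_mul chartAperture.val).const_add 1).const_mul
    (corner i)).sub (hnum.const_mul (corner j))) hden
  refine ⟨_, ?_, hdiv⟩
  refine div_ne_zero ?_ (pow_ne_zero 2 hden)
  have hne : corner i * (conj chartAperture.val - chartAperture.val) * (n * w ^ (n - 1)) ≠ 0 :=
    mul_ne_zero (mul_ne_zero (corner_ne_zero i)
      (neg_sub chartAperture.val _ ▸ neg_ne_zero.2 chartAperture.sub_conj_ne_zero))
      (mul_ne_zero (by exact_mod_cast hn.ne') (pow_ne_zero _ hw))
  convert hne using 1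
  simp only [Pi.sub_apply]
  ring

theorem exists_mem_disc_of_mem_source {α : Aperture} {w : ℂ}
    (hw : w ∈ ((discChart a α i e).symm.trans (discChart a α j e')).source) :
    ∃ q ∈ disc a α i e, q ∈ disc a α j e' ∧ discChart a α i e q = w ∧
      discChart a α j e' q = ((discChart a α i e).symm.trans (discChart a α j e')) w := by
  refine ⟨(discChart a α i e).symm w, ?_, ?_, (discChart a α i e).right_inv hw.1, rfl⟩
  · rw [← discChart_source]
    exact (discChart a α i e).map_target hw.1
  · rw [← discChart_source]
    exact hw.2

open scoped ContDiff in
theorem contDiffOn_det_pos_discChart (hij : i ≠ j) {T : OpenPartialHomeomorph ℂ ℂ}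
    (hT : T = (discChart a chartAperture i e).symm.trans (discChart a chartAperture j e')) :
    ContDiffOn ℝ ∞ T T.source ∧ ∀ z ∈ T.source, 0 < (fderiv ℝ T z).det := by
  have hthird : ∀ i j : ZMod 3, ∃ k, i ≠ k ∧ j ≠ k := by decide
  obtain ⟨k, hki, hkj⟩ := hthird i j
  subst hT
  refine contDiffOn_det_pos_of_comp_eq _ (F := fun w => poleCoord i k (w ^ valency a i e))
    (F' := fun w => poleCoord j k (w ^ valency a j e')) ?_ ?_ ?_ <;> intro w hw <;>
    obtain ⟨q, hq, hq', rfl, hw'⟩ := exists_mem_disc_of_mem_source hw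
  · exact exists_hasStrictDerivAt_poleCoord_pow hki valency_pos (discChart_ne_zero hij hq hq')
      (norm_discChart_pow_lt_one hq)
  · rw [← hw']
    exact exists_hasStrictDerivAt_poleCoord_pow hkj valency_pos
      (discChart_ne_zero hij.symm hq' hq) (norm_discChart_pow_lt_one hq')
  · rw [← hw']
    refine (div_eq_div_iff (corner_mul_sub_corner_mul_ne_zero hkj (norm_discChart_pow_lt_one hq'))
      (corner_mul_sub_corner_mul_ne_zero hki (norm_discChart_pow_lt_one hq))).2 ?_
    linear_combination discChart_relation hq hq' rfl rfl

end Transition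

theorem eq_univ_of_mirrorSwap (htrans : ∀ s : Set E, s.Nonempty →
    (∀ i e, rotation a i e ∈ s ↔ e ∈ s) → s = univ) {s : Set (E × Bool)} (hs : s.Nonempty)
    (hmirror : ∀ i τ, mirrorSwap a i τ ∈ s ↔ τ ∈ s) : s = univ := by
  have htrue : {e | (e, true) ∈ s} = univ := by
    refine htrans _ ?_ fun i e => ?_
    · obtain ⟨⟨e, _ | _⟩, h⟩ := hs
      exacts [⟨(a 0)⁻¹ e, (hmirror 0 (e, false)).2 h⟩, ⟨e, h⟩]
    · have h := (hmirror (i + 2) (a (i + 1) e, false)).trans (hmirror (i + 1) (e, true))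
      exact h
  refine eq_univ_of_forall fun ⟨e, b⟩ => ?_
  cases b
  · exact (hmirror 0 (e, false)).1 (eq_univ_iff_forall.1 htrue _)
  · exact eq_univ_iff_forall.1 htrue e

theorem isOrientableSurface [Finite E] [Nonempty E] (htrans : ∀ s : Set E, s.Nonempty →
    (∀ i e, rotation a i e ∈ s ↔ e ∈ s) → s = univ) :
    IsOrientableSurface (TriangulatedSurface a) where
  t2 := inferInstance
  compact := compactSpace
  connected :=
    have : ConnectedSpace Triangle := Subtype.connectedSpace
      ((convex_closedBall (0 : ℂ) 1).isConnected (nonempty_closedBall.2 zero_le_one))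
    connectedSpace side_nonempty fun _ => eq_univ_of_mirrorSwap htrans
  exists_oriented_atlas := by
    refine ⟨range fun v : Σ i, Quotient (Equiv.Perm.SameCycle.setoid (rotation a i)) =>
      discChart a chartAperture v.1 v.2.out, fun q => ?_, ?_⟩
    · obtain ⟨i, e, h⟩ := exists_mem_disc a q
      refine ⟨_, ⟨⟨i, Quotient.mk _ e⟩, rfl⟩, ?_⟩
      rwa [discChart_source, disc_eq_disc (Quotient.mk_out (s := Equiv.Perm.SameCycle.setoid _) e)]
    · rintro _ ⟨⟨i, v⟩, rfl⟩ _ ⟨⟨j, v'⟩, rfl⟩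
      rcases eq_or_ne i j with rfl | hij
      · rcases eq_or_ne v v' with rfl | hv
        · exact contDiffOn_det_pos_symm_trans_self _
        · have hempty : ∀ z, z ∉ ((discChart a chartAperture i v.out).symm.trans
              (discChart a chartAperture i v'.out)).source := fun z hz => hv (by
            obtain ⟨q, hq, hq', -⟩ := exists_mem_disc_of_mem_source hz
            rw [← v.out_eq, ← v'.out_eq]
            exact Quotient.sound (sameCycle_of_mem_disc hq hq'))
          exact ⟨fun z hz => (hempty z hz).elim, fun z hz => (hempty z hz).elim⟩
      · exact contDiffOn_det_pos_discChart hij rfl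

end Atlas

section MapSurface

open BasicConstruction

variable {E : Type} (next : Bool → Equiv.Perm E)

/-- The gluing of the triangles of a map on a surface: `next c` takes each edge to the following
one along the boundary of the face of colour `c` next to it. The chambers `(e, true)` and
`(e, false)` contain the first and the second half of the edge `e`, and have their corner `0` at
its first and its last vertex; both have their corners `2` and `1` at the centres of the faces of
colours `true` and `false` next to `e`. -/
def mapGluing : ZMod 3 → Equiv.Perm E := ![1, (next true)⁻¹, (next false)⁻¹]

/-- The corner of the chambers at the centres of the faces of colour `c`. -/
def faceCorner : Bool → ZMod 3
  | true => 2
  | false => 1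

/-- The surface of the map with the given successor permutations. -/
abbrev MapSurface : Type := TriangulatedSurface (mapGluing next)

/-- The apertures of the discs around the corners `2` and `1` that are bounded by the real
diameter of the model triangle. -/
noncomputable def faceAperture : Bool → Aperture
  | true => ⟨corner 1, by simp [corner_one], by simp [corner_one]; linarith⟩
  | false => ⟨-corner 2, by simp [corner_two], by simp [corner_two]; linarith⟩

/-- The face of colour `c` next to the edge `e`. -/
def face (c : Bool) (e : E) : Set (MapSurface next) :=
  disc (mapGluing next) (faceAperture c) (faceCorner c) e

theorem im_corner_faceCorner_ne_zero (c : Bool) : (corner (faceCorner c)).im ≠ 0 := by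
  cases c <;> simp [faceCorner, corner_one, corner_two]

theorem excess_faceAperture (c : Bool) (z : Triangle) :
    excess (faceAperture c) (faceCorner c) z =
      ‖(z : ℂ) - corner (faceCorner c)‖ - ‖(z : ℂ) - starRingEnd ℂ (corner (faceCorner c))‖ := by
  have hneg : -(2 : ZMod 3) = 1 := rfl
  have hneg' : -(1 : ZMod 3) = 2 := rfl
  have hmul := corner_neg_mul_corner 1
  rw [hneg'] at hmul
  have hleft : ‖corner (-faceCorner c) * z - 1‖ = ‖(z : ℂ) - corner (faceCorner c)‖ :=
    calc ‖corner (-faceCorner c) * z - 1‖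
      _ = ‖corner (-faceCorner c) * (z - corner (faceCorner c))‖ := by
        rw [mul_sub, corner_neg_mul_corner]
      _ = ‖(z : ℂ) - corner (faceCorner c)‖ := by rw [norm_mul, norm_corner, one_mul]
  rw [excess, hleft]
  cases c
  · simp only [faceAperture, faceCorner, conj_corner, map_neg, hneg, hneg']
    congr 2
    linear_combination (z : ℂ) * hmul
  · simp only [faceAperture, faceCorner, conj_corner, hneg, hneg']
    rw [norm_sub_rev (z : ℂ) (corner 1)]
    congr 2
    linear_combination -(z : ℂ) * hmul

theorem excess_faceAperture_neg_iff (c : Bool) (z : Triangle) :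
    excess (faceAperture c) (faceCorner c) z < 0 ↔
      0 < (z : ℂ).im * (corner (faceCorner c)).im := by
  rw [excess_faceAperture, sub_neg, ← sq_lt_sq₀ (norm_nonneg _) (norm_nonneg _),
    ← Complex.normSq_eq_norm_sq, ← Complex.normSq_eq_norm_sq]
  simp only [Complex.normSq_apply, Complex.sub_re, Complex.sub_im, Complex.conj_re, Complex.conj_im]
  constructor <;> intro h <;> linarith

theorem rotation_zero : rotation (mapGluing next) 0 = next false * (next true)⁻¹ :=
  congrArg (· * (next true)⁻¹) (inv_inv (next false))

theorem rotation_two : rotation (mapGluing next) 2 = next true :=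
  (mul_one _).trans (inv_inv (next true))

variable {next} {c c' : Bool} {e e' : E}

theorem sameCycle_rotation_faceCorner :
    (rotation (mapGluing next) (faceCorner c)).SameCycle e e' ↔ (next c).SameCycle e e' := by
  cases c
  · have : rotation (mapGluing next) 1 = (next false)⁻¹ :=
      congrArg (· * (next false)⁻¹) inv_one
    rw [faceCorner, this, Equiv.Perm.sameCycle_inv]
  · rw [faceCorner, rotation_two]

theorem mem_range_gallery_faceCorner_iff {τ : E × Bool} :
    τ ∈ range (gallery (mapGluing next) (faceCorner c) e) ↔ (next c).SameCycle e τ.1 := by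
  rcases τ with ⟨e', _ | _⟩
  · have hne : 0 ≠ faceCorner c := by cases c <;> decide
    rw [← mirrorSwap_mem_range_gallery_iff hne, mirrorSwap_false, mem_range_gallery_iff,
      sameCycle_rotation_faceCorner]
    rfl
  · rw [mem_range_gallery_iff, sameCycle_rotation_faceCorner]

theorem mk_mem_face_iff {τ : E × Bool} {z : Triangle} :
    mk (mirrorSwap (mapGluing next)) side τ z ∈ face next c e ↔
      (next c).SameCycle e τ.1 ∧ 0 < (z : ℂ).im * (corner (faceCorner c)).im := by
  rw [face, mk_mem_disc_iff, mem_range_gallery_faceCorner_iff, excess_faceAperture_neg_iff]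

theorem eq_of_im_mul_im_pos {y : ℝ} (h : 0 < y * (corner (faceCorner c)).im)
    (h' : 0 < y * (corner (faceCorner c')).im) : c = c' := by
  have : 0 < √3 := by positivity
  cases c <;> cases c' <;> first | rfl | skip
  all_goals
    simp only [faceCorner, corner_one, corner_two] at h h'
    linarith

theorem exists_im_mul_im_pos {y : ℝ} (h : y ≠ 0) : ∃ c, 0 < y * (corner (faceCorner c)).im := by
  rcases h.lt_or_gt with h | h
  · exact ⟨true, mul_pos_of_neg_of_neg h (by simp [faceCorner, corner_two])⟩
  · exact ⟨false, mul_pos h (by simp [faceCorner, corner_one])⟩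

theorem face_congr (h : (next c).SameCycle e e') : face next c e = face next c e' :=
  disc_eq_disc (sameCycle_rotation_faceCorner.2 h)

theorem eq_and_sameCycle_of_mem_face {q : MapSurface next} (h : q ∈ face next c e)
    (h' : q ∈ face next c' e') : c = c' ∧ (next c).SameCycle e e' := by
  obtain ⟨τ, z, rfl⟩ := exists_mk_eq q
  rw [mk_mem_face_iff] at h h'
  obtain rfl := eq_of_im_mul_im_pos h.2 h'.2
  exact ⟨rfl, h.1.trans h'.1.symm⟩

/-- The points of the edges: they lie over the real diameter of the model triangle. -/
def skeleton (next : Bool → Equiv.Perm E) : Set (MapSurface next) :=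
  {q | ((toBase q : Triangle) : ℂ).im = 0}

theorem exists_mem_face_iff {q : MapSurface next} :
    (∃ c e, q ∈ face next c e) ↔ q ∈ (skeleton next)ᶜ := by
  obtain ⟨τ, z, rfl⟩ := exists_mk_eq q
  simp only [mk_mem_face_iff]
  refine ⟨fun ⟨c, e, h⟩ => left_ne_zero_of_mul h.2.ne', fun h => ?_⟩
  obtain ⟨c, hc⟩ := exists_im_mul_im_pos h
  exact ⟨c, τ.1, .refl _ _, hc⟩

theorem isOpen_face : IsOpen (face next c e) := isOpen_disc

theorem face_homeomorph_ball [Finite E] : Nonempty (face next c e ≃ₜ ball (0 : ℂ) 1) := by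
  have h := (discChart (mapGluing next) (faceAperture c) (faceCorner c) e).toHomeomorphSourceTarget
  rw [discChart_source, discChart_target] at h
  exact ⟨h⟩

theorem isConnected_face [Finite E] : IsConnected (face next c e) := by
  obtain ⟨h⟩ := face_homeomorph_ball (next := next) (c := c) (e := e)
  have hball : IsConnected (ball (0 : ℂ) 1) := (convex_ball _ _).isConnected ⟨0, by simp⟩
  rw [isConnected_iff_connectedSpace] at hball ⊢
  exact h.symm.surjective.connectedSpace h.symm.continuous

theorem eq_and_sameCycle_of_face_eq [Finite E] (h : face next c e = face next c' e') :
    c = c' ∧ (next c).SameCycle e e' := by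
  obtain ⟨q, hq⟩ := (isConnected_face (next := next) (c := c) (e := e)).nonempty
  exact eq_and_sameCycle_of_mem_face hq (h ▸ hq)

theorem connectedComponentIn_compl_skeleton [Finite E] {q : MapSurface next}
    (hq : q ∈ face next c e) : connectedComponentIn (skeleton next)ᶜ q = face next c e := by
  have hsub : face next c e ⊆ (skeleton next)ᶜ := fun x hx => exists_mem_face_iff.1 ⟨c, e, hx⟩
  refine Subset.antisymm ?_
    (isConnected_face.isPreconnected.subset_connectedComponentIn hq hsub)
  let others := {F | (∃ c' e', F = face next c' e') ∧ Disjoint (face next c e) F}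
  have hopen : IsOpen (⋃₀ others) := by
    refine isOpen_sUnion ?_
    rintro F ⟨⟨c', e', rfl⟩, -⟩
    exact isOpen_face
  have hdisj : Disjoint (face next c e) (⋃₀ others) :=
    Set.disjoint_sUnion_right.2 fun F hF => hF.2
  have hcover : (skeleton next)ᶜ ⊆ face next c e ∪ ⋃₀ others := fun x hx => by
    obtain ⟨c', e', hx'⟩ := exists_mem_face_iff.2 hx
    refine or_iff_not_imp_left.2 fun hxe =>
      ⟨_, ⟨⟨c', e', rfl⟩, Set.disjoint_left.2 fun y hy hy' => hxe ?_⟩, hx'⟩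
    obtain ⟨rfl, h⟩ := eq_and_sameCycle_of_mem_face hy hy'
    rwa [face_congr h]
  exact isPreconnected_connectedComponentIn.subset_left_of_subset_union isOpen_face hopen hdisj
    ((connectedComponentIn_subset _ _).trans hcover) ⟨q, mem_connectedComponentIn (hsub hq), hq⟩

/-- The point of the real diameter of the model triangle that corresponds to the parameter `r` of
an edge; the diameter is run from `1` to `-1` and back. -/
def axisPoint (r : unitInterval) : Triangle :=
  ⟨(2 * |1 - 2 * (r : ℝ)| - 1 : ℝ), by
    have h : |1 - 2 * (r : ℝ)| ≤ 1 := abs_le.2 ⟨by linarith [r.2.2], by linarith [r.2.1]⟩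
    rw [mem_closedBall_zero_iff, Complex.norm_real, Real.norm_eq_abs]
    exact abs_le.2 ⟨by linarith [abs_nonneg (1 - 2 * (r : ℝ))], by linarith⟩⟩

theorem continuous_axisPoint : Continuous axisPoint := by
  unfold axisPoint
  fun_prop

theorem axisPoint_eq_axisPoint_iff {r r' : unitInterval} :
    axisPoint r = axisPoint r' ↔ |1 - 2 * (r : ℝ)| = |1 - 2 * (r' : ℝ)| := by
  rw [axisPoint, axisPoint, Subtype.mk.injEq, Complex.ofReal_inj, sub_left_inj,
    mul_right_inj' two_ne_zero]

theorem axisPoint_notMem_side {r : unitInterval} (hr : r ∈ Ioo 0 1) {j : ZMod 3} (hj : j ≠ 0) :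
    axisPoint r ∉ side j := by
  rintro ⟨hnorm, hre⟩
  have hlt : |1 - 2 * (r : ℝ)| < 1 := by
    have h0 : 0 < (r : ℝ) := hr.1
    have h1 : (r : ℝ) < 1 := hr.2
    exact abs_lt.2 ⟨by linarith, by linarith⟩
  have hcorner : (corner (-j)).re = -1 / 2 := by
    rcases eq_add_one_or_eq_add_two hj with rfl | rfl <;>
      simp [← conj_corner, corner_one, corner_two]
  rw [axisPoint, Complex.re_mul_ofReal, hcorner] at hre
  rw [axisPoint, Complex.norm_real, Real.norm_eq_abs] at hnorm
  have := abs_nonneg (1 - 2 * (r : ℝ))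
  rcases eq_or_eq_neg_of_abs_eq hnorm with _ | _ <;> linarith

theorem axisPoint_notMem_side_zero {r : unitInterval} (hr : (r : ℝ) ≠ 1 / 2) :
    axisPoint r ∉ side 0 := by
  rintro ⟨hnorm, hre⟩
  have habs : 0 < |1 - 2 * (r : ℝ)| := abs_pos.2 fun h => hr (by linarith)
  rw [neg_zero, corner_zero, one_mul, axisPoint, Complex.ofReal_re] at hre
  rw [axisPoint, Complex.norm_real, Real.norm_eq_abs] at hnorm
  rcases eq_or_eq_neg_of_abs_eq hnorm with h | h <;> linarith

theorem axisPoint_zero : axisPoint 0 = ⟨1, by simp⟩ := by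
  norm_num [axisPoint]

theorem axisPoint_one : axisPoint 1 = ⟨1, by simp⟩ := by
  norm_num [axisPoint]

theorem axisPoint_half {r : unitInterval} (hr : (r : ℝ) = 1 / 2) : axisPoint r ∈ side 0 := by
  norm_num [axisPoint, side, hr, corner_zero]

/-- The point at the parameter `r` of the edge `e`. -/
noncomputable def arcPoint (next : Bool → Equiv.Perm E) (e : E) (r : unitInterval) :
    MapSurface next :=
  mk (mirrorSwap (mapGluing next)) side (e, decide ((r : ℝ) ≤ 1 / 2)) (axisPoint r)

theorem mirrorSwap_mapGluing_zero (e : E) (b : Bool) :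
    mirrorSwap (mapGluing next) 0 (e, b) = (e, !b) := by
  cases b <;> rfl

theorem mk_axisPoint_of_le {r : unitInterval} (hr : (r : ℝ) ≤ 1 / 2) :
    mk (mirrorSwap (mapGluing next)) side (e, true) (axisPoint r) = arcPoint next e r := by
  rw [arcPoint, decide_eq_true hr]

theorem mk_axisPoint_of_ge {r : unitInterval} (hr : 1 / 2 ≤ (r : ℝ)) :
    mk (mirrorSwap (mapGluing next)) side (e, false) (axisPoint r) = arcPoint next e r := by
  rcases hr.eq_or_lt with h | h
  · rw [← mk_axisPoint_of_le h.ge, ← mk_apply_eq (axisPoint_half h.symm), mirrorSwap_mapGluing_zero]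
    rfl
  · rw [arcPoint, decide_eq_false h.not_ge]

theorem continuous_arcPoint : Continuous (arcPoint next e) := by
  have h : arcPoint next e = fun r : unitInterval => if (r : ℝ) ≤ 1 / 2 then
      mk (mirrorSwap (mapGluing next)) side (e, true) (axisPoint r)
      else mk (mirrorSwap (mapGluing next)) side (e, false) (axisPoint r) := by
    funext r
    split_ifs with h
    · exact (mk_axisPoint_of_le h).symm
    · exact (mk_axisPoint_of_ge (not_le.1 h).le).symm
  rw [h]
  refine ((continuous_mk _).comp continuous_axisPoint).if_le
    ((continuous_mk _).comp continuous_axisPoint) continuous_subtype_val continuous_const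
    fun r hr => ?_
  exact (mk_axisPoint_of_le hr.le).trans (mk_axisPoint_of_ge hr.ge).symm

theorem mk_mem_range_arcPoint {z : Triangle} (hz : (z : ℂ).im = 0) (b : Bool) :
    mk (mirrorSwap (mapGluing next)) side (e, b) z ∈ range (arcPoint next e) := by
  have hre := abs_le.1 ((Complex.abs_re_le_norm (z : ℂ)).trans (norm_le_one z))
  have hz' : ((z : ℂ).re : ℂ) = z := Complex.ext rfl hz.symm
  cases b
  · let r : unitInterval := ⟨(3 + (z : ℂ).re) / 4, by linarith, by linarith⟩
    have hr : 1 / 2 ≤ (r : ℝ) := by simp only [r]; linarith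
    have haxis : axisPoint r = z := Subtype.ext <| by
      change ((2 * |1 - 2 * (r : ℝ)| - 1 : ℝ) : ℂ) = z
      rw [abs_of_nonpos (by linarith), ← hz']
      exact congrArg _ (by ring)
    exact ⟨r, by rw [← mk_axisPoint_of_ge hr, haxis]⟩
  · let r : unitInterval := ⟨(1 - (z : ℂ).re) / 4, by linarith, by linarith⟩
    have hr : (r : ℝ) ≤ 1 / 2 := by simp only [r]; linarith
    have haxis : axisPoint r = z := Subtype.ext <| by
      change ((2 * |1 - 2 * (r : ℝ)| - 1 : ℝ) : ℂ) = z
      rw [abs_of_nonneg (by linarith), ← hz']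
      exact congrArg _ (by ring)
    exact ⟨r, by rw [← mk_axisPoint_of_le hr, haxis]⟩

theorem mem_skeleton_iff {q : MapSurface next} :
    q ∈ skeleton next ↔ ∃ e r, arcPoint next e r = q := by
  constructor
  · obtain ⟨⟨e, b⟩, z, rfl⟩ := exists_mk_eq q
    exact fun hz => ⟨e, mk_mem_range_arcPoint hz b⟩
  · rintro ⟨e, r, rfl⟩
    exact Complex.ofReal_im _

theorem arcPoint_one : arcPoint next e 1 = arcPoint next (next true e) 0 := by
  have hswap : mirrorSwap (mapGluing next) 1 (e, false) = (next true e, true) := by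
    rw [mirrorSwap_false]
    exact congrArg (·, true) (congrFun (congrArg _ (inv_inv (next true))) e)
  have hside : axisPoint 0 ∈ side 1 := by
    simp [axisPoint_zero, side, ← conj_corner, corner_one]
  rw [← mk_axisPoint_of_ge (by norm_num), ← mk_axisPoint_of_le (by norm_num), axisPoint_one,
    ← axisPoint_zero, ← hswap, mk_apply_eq hside]

theorem arcPoint_zero_eq_iff : arcPoint next e 0 = arcPoint next e' 0 ↔
    (next false * (next true)⁻¹).SameCycle e e' := by
  have hmk (e : E) : arcPoint next e 0 =
      mk (mirrorSwap (mapGluing next)) side (e, true) (axisPoint 0) :=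
    (mk_axisPoint_of_le (by norm_num)).symm
  rw [hmk, hmk, ← rotation_zero]
  constructor
  · intro h
    obtain ⟨-, g, hg, hge⟩ := mk_eq_mk_iff.1 h
    have hside : ∀ i, axisPoint 0 ∈ side i → i ≠ 0 := by
      rintro _ ⟨-, h⟩ rfl
      norm_num [axisPoint_zero, corner_zero] at h
    rw [← mem_range_gallery_iff, ← hge, apply_mem_iff_of_mem_mirrorGroup (fun i hi =>
      mirrorSwap_mem_range_gallery_iff (hside i hi)) hg, mem_range_gallery_iff]
  · rintro ⟨m, rfl⟩
    have hfold : foldPoint chartAperture 0 0 = axisPoint 0 := Subtype.ext <| by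
      rw [foldPoint_zero, corner_zero, axisPoint_zero]
    have h := mk_gallery_corner (a := mapGluing next) chartAperture 0 e (2 * m)
    rw [gallery_zero, gallery_two_mul, hfold] at h
    exact h.symm

theorem eq_of_arcPoint_eq {r r' : unitInterval} (hr : r ∈ Ioo 0 1)
    (h : arcPoint next e r = arcPoint next e' r') : e = e' ∧ r = r' := by
  obtain ⟨haxis, g, hg, hge⟩ := mk_eq_mk_iff.1 h
  rw [axisPoint_eq_axisPoint_iff] at haxis
  have hside : ∀ i, axisPoint r ∈ side i → i = 0 := fun i hi =>
    by_contra fun hne => axisPoint_notMem_side hr hne hi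
  have hfst : (g (e, decide ((r : ℝ) ≤ 1 / 2))).1 = e := by
    refine (apply_mem_iff_of_mem_mirrorGroup (s := Prod.fst ⁻¹' {e}) (fun i hi => ?_) hg _).2 rfl
    rintro ⟨e'', b⟩
    rw [hside i hi, mirrorSwap_mapGluing_zero]
    rfl
  refine ⟨by rw [← hfst, hge], Subtype.ext ?_⟩
  by_cases hhalf : (r : ℝ) = 1 / 2
  · rw [hhalf, mul_one_div_cancel two_ne_zero, sub_self, abs_zero, eq_comm, abs_eq_zero] at haxis
    linarith
  · have hnone : ∀ i, axisPoint r ∉ side i := fun i hi =>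
      axisPoint_notMem_side_zero hhalf (hside i hi ▸ hi)
    rw [apply_eq_of_mem_mirrorGroup hnone hg, Prod.mk.injEq, decide_eq_decide] at hge
    rcases abs_eq_abs.1 haxis with heq | heq
    · linarith
    · rcases le_total (r : ℝ) (1 / 2) with hle | hle
      · linarith [hge.2.1 hle]
      · linarith [hge.2.2 (by linarith)]

theorem closure_face_subset [Finite E] : closure (face next c e) ⊆
    ⋃ τ ∈ {τ : E × Bool | (next c).SameCycle e τ.1}, mk (mirrorSwap (mapGluing next)) side τ ''
      {z | 0 ≤ (z : ℂ).im * (corner (faceCorner c)).im} := by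
  refine closure_minimal (fun q hq => ?_) ?_
  · obtain ⟨τ, z, rfl⟩ := exists_mk_eq q
    obtain ⟨hτ, hz⟩ := mk_mem_face_iff.1 hq
    exact mem_biUnion (show τ ∈ {τ : E × Bool | (next c).SameCycle e τ.1} from hτ)
      (mem_image_of_mem _ hz.le)
  · refine (toFinite _).isClosed_biUnion fun τ _ => ?_
    have hclosed : IsClosed {z : Triangle | 0 ≤ (z : ℂ).im * (corner (faceCorner c)).im} :=
      isClosed_le continuous_const (by fun_prop)
    exact (hclosed.isCompact.image (continuous_mk τ)).isClosed

theorem mk_mem_closure_face {τ : E × Bool} (hτ : (next c).SameCycle e τ.1) {z : Triangle}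
    (hz : (z : ℂ).im = 0) :
    mk (mirrorSwap (mapGluing next)) side τ z ∈ closure (face next c e) := by
  let w := corner (faceCorner c)
  let path (r : unitInterval) : Triangle := ⟨AffineMap.lineMap (z : ℂ) w (r : ℝ),
    (convex_closedBall (0 : ℂ) 1).lineMap_mem z.2 (by simp [w, norm_corner]) r.2⟩
  have hpath : Continuous path := by
    refine Continuous.subtype_mk ?_ _
    fun_prop
  have hzero : path 0 = z := Subtype.ext (AffineMap.lineMap_apply_zero _ _)
  have hmem : (0 : unitInterval) ∈ closure (Ioi 0) := by
    rw [closure_Ioi' ⟨1, zero_lt_one⟩]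
    exact self_mem_Ici
  rw [← hzero]
  refine map_mem_closure (f := fun r => mk _ side τ (path r)) ((continuous_mk τ).comp hpath) hmem
    fun r hr => ?_
  have him : (path r : ℂ).im = r * w.im := by
    simp [path, AffineMap.lineMap_apply, hz]
  refine mk_mem_face_iff.2 ⟨hτ, ?_⟩
  rw [him, mul_assoc]
  exact mul_pos hr (mul_self_pos.2 (im_corner_faceCorner_ne_zero c))

theorem frontier_face [Finite E] : frontier (face next c e) =
    ⋃ e' ∈ {e' | (next c).SameCycle e e'}, range (arcPoint next e') := by
  rw [isOpen_face.frontier_eq]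
  refine Subset.antisymm ?_ (iUnion₂_subset ?_)
  · rintro q ⟨hq, hqF⟩
    obtain ⟨⟨e', b⟩, he', z, hz, rfl⟩ := mem_iUnion₂.1 (closure_face_subset hq)
    have hzero := hz.eq_or_lt.resolve_right fun hpos => hqF (mk_mem_face_iff.2 ⟨he', hpos⟩)
    have him := (mul_eq_zero.1 hzero.symm).resolve_right (im_corner_faceCorner_ne_zero c)
    exact mem_biUnion he' (mk_mem_range_arcPoint him b)
  · rintro e' (he' : (next c).SameCycle e e') _ ⟨r, rfl⟩
    refine ⟨mk_mem_closure_face he' (Complex.ofReal_im _), fun hmem => ?_⟩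
    exact exists_mem_face_iff.1 ⟨c, e, hmem⟩ (mem_skeleton_iff.2 ⟨e', r, rfl⟩)

end MapSurface

section MapEmbedding

theorem apply_eq_of_sameCycle {α β : Type*} {σ : Equiv.Perm α} {f : α → β}
    (hf : ∀ x, f (σ x) = f x) {x y : α} (h : σ.SameCycle x y) : f x = f y := by
  obtain ⟨m, rfl⟩ := h
  induction m with
  | zero => rfl
  | succ m ih => rw [ih, add_comm, zpow_one_add, Equiv.Perm.mul_apply, hf]
  | pred m ih =>
    rw [ih, ← hf ((σ ^ (-(m : ℤ) - 1)) x), ← Equiv.Perm.mul_apply, ← zpow_one_add, add_sub_cancel]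

variable {E V : Type}

/-- A labelling by `E` of the edges of the multigraph `^λΓ`, together with a choice of a direction
of each edge for which the boundaries of all faces of the map are directed cycles. The edges that
begin at a vertex form one cycle of the permutation that turns around the vertex. -/
structure EdgeLabelling (next : Bool → Equiv.Perm E) (Γ : SimpleGraph V) (lam : ℕ) where
  dart : E → MultiDart Γ lam
  snd_dart : ∀ c e, (dart e).1.snd = (dart (next c e)).1.fst
  sameCycle : ∀ {e e'}, (dart e).1.fst = (dart e').1.fst →
    (next false * (next true)⁻¹).SameCycle e e'
  exists_fst_dart : ∀ x, ∃ e, (dart e).1.fst = x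
  existsUnique : ∀ d : MultiDart Γ lam, ∃! e, ((dart e).1.edge, (dart e).2) = (d.1.edge, d.2)

namespace EdgeLabelling

variable {next : Bool → Equiv.Perm E} {Γ : SimpleGraph V} {lam : ℕ}
  (L : EdgeLabelling next Γ lam)

theorem fst_dart_eq_iff {e e' : E} : (L.dart e).1.fst = (L.dart e').1.fst ↔
    (next false * (next true)⁻¹).SameCycle e e' := by
  refine ⟨L.sameCycle, apply_eq_of_sameCycle (f := fun e => (L.dart e).1.fst) fun e => ?_⟩
  rw [Equiv.Perm.mul_apply, ← L.snd_dart, L.snd_dart true, ← Equiv.Perm.mul_apply, mul_inv_cancel,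
    Equiv.Perm.one_apply]

/-- The label of the undirected edge underlying `d`. -/
noncomputable def edgeOf (d : MultiDart Γ lam) : E := (L.existsUnique d).choose

theorem edgeOf_eq {d : MultiDart Γ lam} {e : E}
    (h : ((L.dart e).1.edge, (L.dart e).2) = (d.1.edge, d.2)) : L.edgeOf d = e :=
  (L.existsUnique d).unique (L.existsUnique d).choose_spec.1 h

theorem eq_dart_edgeOf_or (d : MultiDart Γ lam) : d = L.dart (L.edgeOf d) ∨
    d = ((L.dart (L.edgeOf d)).1.symm, (L.dart (L.edgeOf d)).2) := by
  obtain ⟨hedge, hcopy⟩ := Prod.mk.inj (L.existsUnique d).choose_spec.1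
  exact ((SimpleGraph.dart_edge_eq_iff _ _).1 hedge.symm).imp
    (fun h => Prod.ext h hcopy.symm) (fun h => Prod.ext h hcopy.symm)

theorem edgeOf_dart (e : E) : L.edgeOf (L.dart e) = e := L.edgeOf_eq rfl

theorem edgeOf_symm (e : E) : L.edgeOf ((L.dart e).1.symm, (L.dart e).2) = e :=
  L.edgeOf_eq (by rw [SimpleGraph.Dart.edge_symm])

/-- The point of the surface at which the vertex `x` is drawn. -/
noncomputable def vertexPoint (x : V) : MapSurface next :=
  arcPoint next (L.exists_fst_dart x).choose 0

theorem arcPoint_zero (e : E) : arcPoint next e 0 = L.vertexPoint (L.dart e).1.fst :=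
  arcPoint_zero_eq_iff.2 (L.sameCycle (L.exists_fst_dart _).choose_spec.symm)

theorem arcPoint_one (e : E) : arcPoint next e 1 = L.vertexPoint (L.dart e).1.snd := by
  rw [HeffterBiembedding.arcPoint_one, L.arcPoint_zero, ← L.snd_dart]

theorem vertexPoint_injective : Function.Injective L.vertexPoint := fun x y h => by
  rw [← (L.exists_fst_dart x).choose_spec, ← (L.exists_fst_dart y).choose_spec, L.fst_dart_eq_iff]
  exact arcPoint_zero_eq_iff.1 h

open Classical in
/-- The point of the surface at which the point at the parameter `r` of `d` is drawn. -/
noncomputable def dartPoint (d : MultiDart Γ lam) (r : unitInterval) : MapSurface next :=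
  arcPoint next (L.edgeOf d) (if d = L.dart (L.edgeOf d) then r else unitInterval.symm r)

theorem dartPoint_dart (e : E) (r : unitInterval) :
    L.dartPoint (L.dart e) r = arcPoint next e r := by
  rw [dartPoint, edgeOf_dart, if_pos rfl]

theorem dartPoint_symm (e : E) (r : unitInterval) :
    L.dartPoint ((L.dart e).1.symm, (L.dart e).2) r = arcPoint next e (unitInterval.symm r) := by
  rw [dartPoint, edgeOf_symm, if_neg fun h => (L.dart e).1.symm_ne (congrArg Prod.fst h)]

theorem continuous_dartPoint (d : MultiDart Γ lam) : Continuous (L.dartPoint d) := by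
  unfold dartPoint
  split_ifs
  · exact continuous_arcPoint
  · exact continuous_arcPoint.comp unitInterval.continuous_symm

/-- The embedding of the multigraph in the surface of the map. -/
noncomputable def embed : Realization Γ lam → MapSurface next :=
  Quot.lift (Sum.elim (fun x => L.vertexPoint x.1) fun a => L.dartPoint a.1 a.2) fun _ _ h => by
    cases h with
    | source d =>
      obtain ⟨e, rfl | rfl⟩ : ∃ e, d = L.dart e ∨ d = ((L.dart e).1.symm, (L.dart e).2) :=
        ⟨_, L.eq_dart_edgeOf_or d⟩
      · exact (L.dartPoint_dart e 0).trans (L.arcPoint_zero e)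
      · rw [Sum.elim_inr, L.dartPoint_symm, unitInterval.symm_zero]
        exact L.arcPoint_one e
    | flip d r =>
      obtain ⟨e, rfl | rfl⟩ : ∃ e, d = L.dart e ∨ d = ((L.dart e).1.symm, (L.dart e).2) :=
        ⟨_, L.eq_dart_edgeOf_or d⟩
      · rw [Sum.elim_inr, Sum.elim_inr, L.dartPoint_symm, L.dartPoint_dart, unitInterval.symm_symm]
      · rw [Sum.elim_inr, Sum.elim_inr, L.dartPoint_symm, SimpleGraph.Dart.symm_symm]
        exact (L.dartPoint_dart e _).symm

theorem continuous_embed : Continuous L.embed :=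
  continuous_quot_lift _ (continuous_sum_dom.2 ⟨
    continuous_sigma fun x => (continuous_const : Continuous fun _ : Unit => L.vertexPoint x),
    continuous_sigma fun d => L.continuous_dartPoint d⟩)

/-- The point of the multigraph at the parameter `r` of the edge `e`. -/
def arc (e : E) (r : unitInterval) : Realization Γ lam := Quot.mk _ (Sum.inr ⟨L.dart e, r⟩)

theorem embed_arc (e : E) (r : unitInterval) : L.embed (L.arc e r) = arcPoint next e r :=
  L.dartPoint_dart e r

theorem arc_zero (e : E) : L.arc e 0 = Quot.mk _ (Sum.inl ⟨(L.dart e).1.fst, ()⟩) :=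
  Quot.sound (Glue.source _)

theorem arc_one (e : E) : L.arc e 1 = Quot.mk _ (Sum.inl ⟨(L.dart e).1.snd, ()⟩) := by
  rw [arc, Quot.sound (Glue.flip _ _), unitInterval.symm_one]
  exact Quot.sound (Glue.source _)

theorem edgeArc_eq (d : MultiDart Γ lam) : edgeArc d = range (L.arc (L.edgeOf d)) := by
  rcases L.eq_dart_edgeOf_or d with h | h
  · conv_lhs => rw [h]
    rfl
  · have hflip (r : unitInterval) : (Quot.mk _ (Sum.inr ⟨d, r⟩) : Realization Γ lam) =
        L.arc (L.edgeOf d) (unitInterval.symm r) := by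
      have hd : L.dart (L.edgeOf d) = (d.1.symm, d.2) := by
        conv_rhs => rw [h]
        rw [SimpleGraph.Dart.symm_symm]
      rw [arc, hd]
      exact Quot.sound (Glue.flip d r)
    rw [edgeArc, funext hflip]
    exact unitInterval.symm_bijective.surjective.range_comp (L.arc (L.edgeOf d))

theorem image_edgeArc (d : MultiDart Γ lam) :
    L.embed '' edgeArc d = range (arcPoint next (L.edgeOf d)) := by
  rw [edgeArc_eq L, ← range_comp]
  exact congrArg range (funext (L.embed_arc _))

theorem exists_arc_eq (q : Realization Γ lam) : ∃ e r, L.arc e r = q := by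
  induction q using Quot.ind with
  | mk a =>
    rcases a with ⟨x, ⟨⟩⟩ | ⟨d, r⟩
    · obtain ⟨e, rfl⟩ := L.exists_fst_dart x
      exact ⟨e, 0, L.arc_zero e⟩
    · exact ⟨_, (L.edgeArc_eq d).subset ⟨r, rfl⟩⟩

theorem exists_arc_eq_vertex {e : E} {r : unitInterval} (hr : r ∉ Ioo 0 1) :
    ∃ x, L.arc e r = Quot.mk _ (Sum.inl ⟨x, ()⟩) := by
  have h : r = 0 ∨ r = 1 := by
    by_contra! h
    exact hr ⟨unitInterval.pos_iff_ne_zero.2 h.1, unitInterval.lt_one_iff_ne_one.2 h.2⟩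
  rcases h with rfl | rfl
  · exact ⟨_, L.arc_zero e⟩
  · exact ⟨_, L.arc_one e⟩

theorem embed_injective : Function.Injective L.embed := by
  intro q q' h
  obtain ⟨e, r, rfl⟩ := L.exists_arc_eq q
  obtain ⟨e', r', rfl⟩ := L.exists_arc_eq q'
  have harc := h
  rw [L.embed_arc, L.embed_arc] at harc
  by_cases hr : r ∈ Ioo 0 1
  · obtain ⟨rfl, rfl⟩ := eq_of_arcPoint_eq hr harc
    rfl
  by_cases hr' : r' ∈ Ioo 0 1
  · obtain ⟨rfl, rfl⟩ := eq_of_arcPoint_eq hr' harc.symm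
    rfl
  obtain ⟨x, hx⟩ := L.exists_arc_eq_vertex (e := e) hr
  obtain ⟨x', hx'⟩ := L.exists_arc_eq_vertex (e := e') hr'
  rw [hx, hx'] at h
  obtain rfl : x = x' := L.vertexPoint_injective h
  exact hx.trans hx'.symm

theorem range_embed : range L.embed = skeleton next := by
  ext q
  rw [mem_skeleton_iff]
  constructor
  · rintro ⟨a, rfl⟩
    obtain ⟨e, r, rfl⟩ := L.exists_arc_eq a
    exact ⟨e, r, (L.embed_arc e r).symm⟩
  · rintro ⟨e, r, rfl⟩
    exact ⟨L.arc e r, L.embed_arc e r⟩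

theorem eq_univ_of_rotation_mem_iff [NeZero lam] (L : EdgeLabelling next Γ lam) (hΓ : Γ.Connected)
    {s : Set E} (hs : s.Nonempty)
    (h : ∀ i e, rotation (mapGluing next) i e ∈ s ↔ e ∈ s) : s = univ := by
  have hfst_mem {e e' : E} (he : (L.dart e).1.fst = (L.dart e').1.fst) : e ∈ s ↔ e' ∈ s := by
    have hrot := h 0
    rw [rotation_zero] at hrot
    exact (apply_eq_of_sameCycle (fun e => propext (hrot e)) (L.sameCycle he)).to_iff
  have hnext (e : E) : next true e ∈ s ↔ e ∈ s := by
    rw [← rotation_two next, h]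
  have hadj {x y : V} (hxy : Γ.Adj x y) :
      (∃ e ∈ s, (L.dart e).1.fst = x) → ∃ e ∈ s, (L.dart e).1.fst = y := by
    rintro ⟨e, he, hx⟩
    let d : MultiDart Γ lam := (⟨(x, y), hxy⟩, 0)
    rcases L.eq_dart_edgeOf_or d with hd | hd
    · have hfst : x = (L.dart (L.edgeOf d)).1.fst := congrArg (fun d => d.1.fst) hd
      have hsnd : y = (L.dart (L.edgeOf d)).1.snd := congrArg (fun d => d.1.snd) hd
      exact ⟨_, (hnext _).2 ((hfst_mem (hx.trans hfst)).1 he), by rw [← L.snd_dart, hsnd]⟩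
    · have hfst : x = (L.dart (L.edgeOf d)).1.snd := congrArg (fun d => d.1.fst) hd
      have hsnd : y = (L.dart (L.edgeOf d)).1.fst := congrArg (fun d => d.1.snd) hd
      rw [L.snd_dart true] at hfst
      exact ⟨_, (hnext _).1 ((hfst_mem (hx.trans hfst)).1 he), hsnd.symm⟩
  obtain ⟨e, he⟩ := hs
  refine eq_univ_of_forall fun e' => ?_
  obtain ⟨e'', he'', h'⟩ := ((hΓ.preconnected (L.dart e).1.fst (L.dart e').1.fst).elim fun walk =>
    walk.rec (motive := fun x y _ => (∃ e ∈ s, (L.dart e).1.fst = x) →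
      ∃ e ∈ s, (L.dart e).1.fst = y) id fun hxy _ ih => ih ∘ hadj hxy) ⟨e, he, rfl⟩
  exact (hfst_mem h').1 he''

variable [Finite E]

theorem isFace_embed_iff {F : Set (MapSurface next)} :
    IsFace L.embed F ↔ ∃ c e, F = face next c e := by
  rw [IsFace, L.range_embed]
  constructor
  · rintro ⟨q, hq, rfl⟩
    obtain ⟨c, e, h⟩ := exists_mem_face_iff.2 hq
    exact ⟨c, e, connectedComponentIn_compl_skeleton h⟩
  · rintro ⟨c, e, rfl⟩
    obtain ⟨q, hq⟩ := (isConnected_face (next := next) (c := c) (e := e)).nonempty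
    exact ⟨q, exists_mem_face_iff.1 ⟨c, e, hq⟩, (connectedComponentIn_compl_skeleton hq).symm⟩

theorem isCellular_embed : IsCellular L.embed := by
  intro F hF
  obtain ⟨c, e, rfl⟩ := L.isFace_embed_iff.1 hF
  exact face_homeomorph_ball

theorem sameCycle_edgeOf {c : Bool} {e : E} {d : MultiDart Γ lam}
    (h : L.embed '' edgeArc d ⊆ frontier (face next c e)) : (next c).SameCycle e (L.edgeOf d) := by
  let r : unitInterval := ⟨1 / 2, by norm_num, by norm_num⟩
  have hr : r ∈ Ioo 0 1 := by
    constructor <;> rw [← Subtype.coe_lt_coe] <;> norm_num [r]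
  rw [L.image_edgeArc, frontier_face] at h
  obtain ⟨e', he', r', hr'⟩ := mem_iUnion₂.1 (h ⟨r, rfl⟩)
  obtain ⟨rfl, -⟩ := eq_of_arcPoint_eq hr hr'.symm
  exact he'

end EdgeLabelling

/-- A listing of the edges of the faces of colour `c` of a map, the face `i` being bounded by the
cycle of the edges `edge (i, 0), …, edge (i, ℓ - 1)`. -/
structure FaceTracing {next : Bool → Equiv.Perm E} {Γ : SimpleGraph V} {lam : ℕ}
    (L : EdgeLabelling next Γ lam) (c : Bool) (I : Type) (ℓ : ℕ) where
  two_le : 2 ≤ ℓ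
  edge : I × Fin ℓ ≃ E
  next_edge : ∀ i j, next c (edge (i, j)) = edge (i, finRotate ℓ j)
  vertex_injective : ∀ i, Function.Injective fun j => (L.dart (edge (i, j))).1.fst

namespace FaceTracing

variable {next : Bool → Equiv.Perm E} {Γ : SimpleGraph V} {lam ℓ ℓ' : ℕ}
  {L : EdgeLabelling next Γ lam} {c : Bool} {I I' : Type} (T : FaceTracing L c I ℓ)

/-- The cycle of the multigraph that bounds the face `i`. -/
def cycle (i : I) : MultiCycle Γ lam ℓ where
  two_le := T.two_le
  dart j := L.dart (T.edge (i, j))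
  closed j := by rw [L.snd_dart c, T.next_edge]
  vertex_injective := T.vertex_injective i
  edge_injective j j' h :=
    congrArg Prod.snd (T.edge.injective ((L.existsUnique _).unique rfl h.symm))

/-- The face `i`. -/
def tracedFace (i : I) : Set (MapSurface next) :=
  face next c (T.edge (i, ⟨0, zero_lt_two.trans_le T.two_le⟩))

theorem isCycleDecomposition : IsCycleDecomposition T.cycle := by
  intro ε hε l
  induction ε using Sym2.ind with
  | _ x y =>
    obtain ⟨e, he, hunique⟩ := L.existsUnique (⟨(x, y), hε⟩, l)
    refine ⟨T.edge.symm e, ?_, fun p hp => T.edge.eq_symm_apply.2 (hunique _ hp)⟩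
    change ((L.dart (T.edge (T.edge.symm e))).1.edge, (L.dart (T.edge (T.edge.symm e))).2) = _
    rw [T.edge.apply_symm_apply]
    exact he

theorem sameCycle_edge_iff {i : I} {j : Fin ℓ} {e : E} :
    (next c).SameCycle (T.edge (i, j)) e ↔ ∃ j', T.edge (i, j') = e := by
  constructor
  · intro h
    have hfst := apply_eq_of_sameCycle (f := fun e => (T.edge.symm e).1) (fun e => by
      obtain ⟨⟨i, j⟩, rfl⟩ := T.edge.surjective e
      rw [T.next_edge, Equiv.symm_apply_apply, Equiv.symm_apply_apply]) h
    rw [Equiv.symm_apply_apply] at hfst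
    exact ⟨(T.edge.symm e).2, T.edge.eq_symm_apply.1 (Prod.ext hfst rfl)⟩
  · rintro ⟨j', rfl⟩
    have hmoved (j : Fin ℓ) : finRotate ℓ j ≠ j := by
      rw [← Equiv.Perm.mem_support, support_finRotate_of_le T.two_le]
      exact Finset.mem_univ j
    obtain ⟨m, rfl⟩ := (isCycle_finRotate_of_le T.two_le).exists_pow_eq (hmoved j) (hmoved j')
    refine ⟨m, ?_⟩
    rw [zpow_natCast]
    induction m with
    | zero => rfl
    | succ m ih => rw [pow_succ', pow_succ', Equiv.Perm.mul_apply, ih, T.next_edge]; rfl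

variable [Finite E]

theorem frontier_tracedFace (i : I) :
    frontier (T.tracedFace i) = L.embed '' (T.cycle i).carrier := by
  rw [tracedFace, frontier_face, MultiCycle.carrier, image_iUnion]
  simp only [L.image_edgeArc, sameCycle_edge_iff]
  ext q
  simp only [mem_iUnion, exists_prop, mem_ofPred, exists_exists_eq_and, cycle, L.edgeOf_dart]

theorem bijOn_tracedFace : BijOn T.tracedFace univ {F | ∃ e, F = face next c e} := by
  refine ⟨fun i _ => ⟨_, rfl⟩, fun i _ i' _ h => ?_, ?_⟩
  · obtain ⟨j', h'⟩ := T.sameCycle_edge_iff.1 (eq_and_sameCycle_of_face_eq h).2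
    exact congrArg Prod.fst (T.edge.injective h')
  · rintro F ⟨e, rfl⟩
    obtain ⟨⟨i, j⟩, rfl⟩ := T.edge.surjective e
    exact ⟨i, mem_univ i, face_congr (T.sameCycle_edge_iff.2 ⟨j, rfl⟩)⟩

open Classical in
theorem isBiembedding (T : FaceTracing L true I ℓ) (T' : FaceTracing L false I' ℓ') :
    IsBiembedding L.embed T.cycle T'.cycle := by
  let color (F : Set (MapSurface next)) : Bool := decide (∃ e, F = face next true e)
  have hcolor (c : Bool) (e : E) : color (face next c e) = c := by
    cases c
    · refine decide_eq_false fun ⟨e', h⟩ => ?_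
      exact Bool.false_ne_true (eq_and_sameCycle_of_face_eq h).1
    · exact decide_eq_true ⟨e, rfl⟩
  have hfaces (c : Bool) :
      {F | IsFace L.embed F ∧ color F = c} = {F | ∃ e, F = face next c e} := by
    ext F
    constructor
    · rintro ⟨hF, hc⟩
      obtain ⟨c', e, rfl⟩ := L.isFace_embed_iff.1 hF
      obtain rfl := (hcolor c' e).symm.trans hc
      exact ⟨e, rfl⟩
    · rintro ⟨e, rfl⟩
      exact ⟨L.isFace_embed_iff.2 ⟨c, e, rfl⟩, hcolor c e⟩
  refine ⟨T.isCycleDecomposition, T'.isCycleDecomposition,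
    ⟨L.continuous_embed, L.embed_injective⟩, color, ?_,
    ⟨T.tracedFace, hfaces true ▸ T.bijOn_tracedFace, T.frontier_tracedFace⟩,
    ⟨T'.tracedFace, hfaces false ▸ T'.bijOn_tracedFace, T'.frontier_tracedFace⟩⟩
  intro F F' hF hF' hne d hd hd' hc
  obtain ⟨c, e, rfl⟩ := L.isFace_embed_iff.1 hF
  obtain ⟨c', e', rfl⟩ := L.isFace_embed_iff.1 hF'
  rw [hcolor, hcolor] at hc
  subst hc
  exact hne (face_congr ((L.sameCycle_edgeOf hd).trans (L.sameCycle_edgeOf hd').symm))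

end FaceTracing

end MapEmbedding

section LineCycles

namespace LineOrdering

variable {B ι G : Type} {line : B → ι} [AddCommGroup G] (ω : LineOrdering line) (a : B → G)

theorem line_perm (b : B) : line (ω.perm b) = line b :=
  (ω.isCycleOn (line b)).1.mapsTo (show b ∈ {b' | line b' = line b} from rfl)

theorem line_perm_pow (n : ℕ) (b : B) : line ((ω.perm ^ n) b) = line b := by
  induction n with
  | zero => rfl
  | succ n ih => rw [pow_succ', Equiv.Perm.mul_apply, ω.line_perm, ih]

theorem partialSum_succ (i : ι) (j : ℕ) :
    ω.partialSum a i (j + 1) = ω.partialSum a i j + a ((ω.perm ^ j) (ω.start i)) :=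
  Finset.sum_range_succ _ _

theorem partialSum_zero (i : ι) : ω.partialSum a i 0 = 0 := Finset.sum_range_zero _

variable {ω a} in
theorem IsSimple.injOn_Iio {ℓ : ℕ} {i : ι} (h : ω.IsSimple a ℓ) (hsum : ω.partialSum a i ℓ = 0) :
    InjOn (ω.partialSum a i) (Iio ℓ) := by
  have hzero {j : ℕ} (hj : j ∈ Iio ℓ) (hj0 : 0 < j) : ω.partialSum a i j ≠ ω.partialSum a i 0 := by
    rw [partialSum_zero, ← hsum]
    exact fun heq => (mem_Iio.1 hj).ne
      (h i ⟨hj0, (mem_Iio.1 hj).le⟩ ⟨hj0.trans (mem_Iio.1 hj), le_rfl⟩ heq)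
  intro j hj j' hj' heq
  rcases j.eq_zero_or_pos with rfl | hpos <;> rcases j'.eq_zero_or_pos with rfl | hpos'
  · rfl
  · exact absurd heq.symm (hzero hj' hpos')
  · exact absurd heq (hzero hj hpos)
  · exact h i ⟨hpos, (mem_Iio.1 hj).le⟩ ⟨hpos', (mem_Iio.1 hj').le⟩ heq

section Finite

variable [Fintype B] [DecidableEq ι] {ℓ : ℕ}

theorem isCycleOn_filter (i : ι) :
    ω.perm.IsCycleOn (Finset.univ.filter fun b => line b = i : Finset B) := by
  rw [Finset.coe_filter_univ]
  exact ω.isCycleOn i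

theorem start_mem_filter (i : ι) : ω.start i ∈ Finset.univ.filter fun b => line b = i :=
  Finset.mem_filter.2 ⟨Finset.mem_univ _, ω.line_start i⟩

theorem perm_pow_eq_iff (hℓ : ∀ i, Fintype.card {b // line b = i} = ℓ) (i : ι)
    {j j' : ℕ} :
    (ω.perm ^ j) (ω.start i) = (ω.perm ^ j') (ω.start i) ↔ j ≡ j' [MOD ℓ] := by
  rw [(ω.isCycleOn_filter i).pow_apply_eq_pow_apply (ω.start_mem_filter i),
    ← Fintype.card_subtype, hℓ]

theorem perm_pow_length (hℓ : ∀ i, Fintype.card {b // line b = i} = ℓ) (i : ι) :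
    (ω.perm ^ ℓ) (ω.start i) = ω.start i := by
  rw [← hℓ i, Fintype.card_subtype]
  exact (ω.isCycleOn_filter i).pow_card_apply (ω.start_mem_filter i)

theorem exists_perm_pow_eq (hℓ : ∀ i, Fintype.card {b // line b = i} = ℓ) (b : B) :
    ∃ j < ℓ, (ω.perm ^ j) (ω.start (line b)) = b := by
  rw [← hℓ (line b), Fintype.card_subtype]
  exact (ω.isCycleOn_filter _).exists_pow_eq (ω.start_mem_filter _)
    (Finset.mem_filter.2 ⟨Finset.mem_univ b, rfl⟩)

theorem partialSum_length (hℓ : ∀ i, Fintype.card {b // line b = i} = ℓ) (i : ι) :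
    ω.partialSum a i ℓ = ∑ b : {b // line b = i}, a b := by
  refine Finset.sum_bij (fun j _ => ⟨(ω.perm ^ j) (ω.start i), ?_⟩) (fun _ _ => Finset.mem_univ _)
    (fun j hj j' hj' h => ?_) (fun b _ => ?_) fun _ _ => rfl
  · rw [ω.line_perm_pow, ω.line_start]
  · rw [Finset.mem_range] at hj hj'
    exact ((ω.perm_pow_eq_iff hℓ i).1 (congrArg Subtype.val h)).eq_of_lt_of_lt hj hj'
  · obtain ⟨b, rfl⟩ := b
    obtain ⟨j, hj, h⟩ := ω.exists_perm_pow_eq hℓ b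
    exact ⟨j, Finset.mem_range.2 hj, Subtype.ext h⟩

theorem inv_perm_pow_start (hℓ : ∀ i, Fintype.card {b // line b = i} = ℓ) (i : ι)
    {j : ℕ} (hj : j < ℓ) :
    (ω.inv.perm ^ j) (ω.inv.start i) = (ω.perm ^ (ℓ - (j + 1))) (ω.start i) := by
  change (ω.perm⁻¹ ^ j) (ω.perm⁻¹ (ω.start i)) = _
  rw [← Equiv.Perm.mul_apply, ← pow_succ, inv_pow, Equiv.Perm.inv_eq_iff_eq,
    ← Equiv.Perm.mul_apply, ← pow_add, Nat.add_sub_cancel' hj, ω.perm_pow_length hℓ]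

variable {a}

theorem inv_partialSum (hℓ : ∀ i, Fintype.card {b // line b = i} = ℓ) {i : ι}
    (hsum : ω.partialSum a i ℓ = 0) {j : ℕ} (hj : j ≤ ℓ) :
    ω.inv.partialSum a i j = -ω.partialSum a i (ℓ - j) := by
  induction j with
  | zero => rw [partialSum_zero, Nat.sub_zero, hsum, neg_zero]
  | succ j ih =>
    have hsub : ℓ - j = ℓ - (j + 1) + 1 := by omega
    rw [partialSum_succ, ih (by omega), hsub, partialSum_succ, ω.inv_perm_pow_start hℓ i hj]
    abel

variable {ω} in
theorem IsSimple.inv (hℓ : ∀ i, Fintype.card {b // line b = i} = ℓ)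
    (hsum : ∀ i, ω.partialSum a i ℓ = 0) (h : ω.IsSimple a ℓ) :
    ω.inv.IsSimple a ℓ := by
  rintro i j ⟨hj, hjℓ⟩ j' ⟨hj', hjℓ'⟩ heq
  rw [ω.inv_partialSum hℓ (hsum i) hjℓ, ω.inv_partialSum hℓ (hsum i) hjℓ'] at heq
  have := h.injOn_Iio (hsum i) (mem_Iio.2 (by omega)) (mem_Iio.2 (by omega)) (neg_injective heq)
  omega

end Finite

/-- The pair `(b, x)` stands for the edge from `x` to `x + a b`; `shift` sends an edge of a cycle of
`D_ω` to the next edge of the cycle. -/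
def shift : Equiv.Perm (B × G) where
  toFun e := (ω.perm e.1, e.2 + a e.1)
  invFun e := (ω.perm⁻¹ e.1, e.2 - a (ω.perm⁻¹ e.1))
  left_inv e := by simp
  right_inv e := by simp

/-- The `j`-th edge of the cycle of `D_ω` with index `q`. It begins at the partial sum `s_{j+1}`, so
that the cell `start` belongs to the last edge. -/
def cycleEdge (q : ι × G) (j : ℕ) : B × G :=
  ((ω.perm ^ (j + 1)) (ω.start q.1), ω.partialSum a q.1 (j + 1) + q.2)

theorem cycleEdge_succ (q : ι × G) (j : ℕ) :
    ω.cycleEdge a q (j + 1) = ω.shift a (ω.cycleEdge a q j) := by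
  refine Prod.ext (by rw [cycleEdge, pow_succ' _ (j + 1)]; rfl) ?_
  exact (congrArg (· + q.2) (ω.partialSum_succ a q.1 (j + 1))).trans (add_right_comm _ _ _)

variable [Fintype B] [DecidableEq ι] {ℓ : ℕ}

variable {a} in
theorem cycleEdge_length (hℓ : ∀ i, Fintype.card {b // line b = i} = ℓ)
    (hsum : ∀ i, ω.partialSum a i ℓ = 0) (q : ι × G) :
    ω.cycleEdge a q ℓ = ω.cycleEdge a q 0 := by
  rw [cycleEdge, cycleEdge, partialSum_succ, hsum, pow_succ', Equiv.Perm.mul_apply,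
    ω.perm_pow_length hℓ, partialSum_succ, partialSum_zero]
  rfl

theorem cycleEdge_bijective (hℓ : ∀ i, Fintype.card {b // line b = i} = ℓ) :
    Function.Bijective fun p : (ι × G) × Fin ℓ => ω.cycleEdge a p.1 p.2 := by
  constructor
  · rintro ⟨⟨i, g⟩, j⟩ ⟨⟨i', g'⟩, j'⟩ h
    obtain ⟨hcell, hvertex⟩ := Prod.mk.inj h
    obtain rfl : i = i' := by
      simpa only [ω.line_perm_pow, ω.line_start] using congrArg line hcell
    obtain rfl : j = j' := Fin.ext <|
      (Nat.ModEq.add_right_cancel' 1 ((ω.perm_pow_eq_iff hℓ i).1 hcell)).eq_of_lt_of_lt j.2 j'.2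
    obtain rfl : g = g' := add_left_cancel hvertex
    rfl
  · rintro ⟨b, x⟩
    obtain ⟨b, rfl⟩ := ω.perm.surjective b
    obtain ⟨j, hj, hb⟩ := ω.exists_perm_pow_eq hℓ b
    refine ⟨((line b, x - ω.partialSum a (line b) (j + 1)), ⟨j, hj⟩), Prod.ext ?_ ?_⟩
    · change (ω.perm ^ (j + 1)) (ω.start (line b)) = ω.perm b
      rw [pow_succ', Equiv.Perm.mul_apply, hb]
    · exact add_sub_cancel _ _

theorem two_le_length [Nonempty B] (hℓ : ∀ i, Fintype.card {b // line b = i} = ℓ)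
    (hsum : ∀ i, ω.partialSum a i ℓ = 0) (hne : ∀ b, a b ≠ 0) : 2 ≤ ℓ := by
  obtain ⟨b⟩ := ‹Nonempty B›
  obtain ⟨j, hj, -⟩ := ω.exists_perm_pow_eq hℓ b
  have hℓ1 : ℓ ≠ 1 := by
    rintro rfl
    refine hne (ω.start (line b)) ?_
    rw [← hsum (line b), partialSum_succ, partialSum_zero, zero_add]
    rfl
  omega

variable {a} in
/-- If `shift` takes each edge to the next one around the face of colour `c`, then the cycles of
`D_ω` bound these faces. -/
noncomputable def faceTracing [Nonempty B] {next : Bool → Equiv.Perm (B × G)} {Γ : SimpleGraph G}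
    {lam : ℕ} {L : EdgeLabelling next Γ lam} {c : Bool}
    (hℓ : ∀ i, Fintype.card {b // line b = i} = ℓ) (hnext : next c = ω.shift a)
    (hfst : ∀ e, (L.dart e).1.fst = e.2) (hsum : ∀ i, ω.partialSum a i ℓ = 0) (hne : ∀ b, a b ≠ 0)
    (hω : ω.IsSimple a ℓ) : FaceTracing L c (ι × G) ℓ where
  two_le := ω.two_le_length a hℓ hsum hne
  edge := Equiv.ofBijective _ (ω.cycleEdge_bijective a hℓ)
  next_edge q j := by
    simp only [Equiv.ofBijective_apply, hnext, ← cycleEdge_succ]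
    cases ℓ with
    | zero => exact j.elim0
    | succ ℓ =>
      rw [coe_finRotate]
      split_ifs with hj
      · rw [hj, Fin.val_last, ω.cycleEdge_length hℓ hsum]
      · rfl
  vertex_injective q j j' h := by
    simp only [hfst, Equiv.ofBijective_apply] at h
    have := hω q.1 ⟨Nat.le_add_left _ _, j.2⟩ ⟨Nat.le_add_left _ _, j'.2⟩ (add_right_cancel h)
    omega

end LineOrdering

/-- The permutations of the edges around the faces of the Heffter map: those of colour `true` trace
the cycles of `D_{ω⁻¹}`, those of colour `false` the cycles of `D_{ω'}`. -/
def heffterNext {B ι ι' G : Type} [AddCommGroup G] {line : B → ι} {line' : B → ι'}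
    (ω : LineOrdering line) (ω' : LineOrdering line') (a : B → G) : Bool → Equiv.Perm (B × G)
  | true => ω.inv.shift a
  | false => ω'.shift a

/-- The edges that begin at a vertex are permuted as the cells are by `ω' ∘ ω`: this is why the
rows are listed backwards. -/
theorem heffterNext_vertex_apply {B ι ι' G : Type} [AddCommGroup G] {line : B → ι}
    {line' : B → ι'} (ω : LineOrdering line) (ω' : LineOrdering line') (a : B → G) (b : B) (x : G) :
    (heffterNext ω ω' a false * (heffterNext ω ω' a true)⁻¹) (b, x) =
      ((ω'.perm * ω.perm) b, x) :=
  Prod.ext rfl (sub_add_cancel x (a (ω.perm b)))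

end LineCycles

section CosetGraph

theorem exists_equiv_prod_fin {E X : Type*} {t : ℕ} (ht : t ≠ 0) (f : E → X)
    (hf : ∀ x, Nat.card {e // f e = x} = t) : ∃ φ : E ≃ X × Fin t, ∀ e, (φ e).1 = f e := by
  have hfiber (x : X) : Nonempty ({e // f e = x} ≃ Fin t) :=
    have : Finite {e // f e = x} := Nat.finite_of_card_ne_zero ((hf x).trans_ne ht)
    ⟨Finite.equivFinOfCardEq (hf x)⟩
  exact ⟨(Equiv.sigmaFiberEquiv f).symm.trans ((Equiv.sigmaCongrRight fun x =>
    (hfiber x).some).trans (Equiv.sigmaEquivProd X (Fin t))), fun _ => rfl⟩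

variable {G : Type} [AddCommGroup G] (J : AddSubgroup G)

theorem nonempty_cosetGraph_iso [Finite G] {r t : ℕ} (ht : Nat.card J = t)
    (hr : Nat.card G = r * t) :
    Nonempty (cosetGraph J ≃g SimpleGraph.completeEquipartiteGraph r t) := by
  have ht0 : t ≠ 0 := ht ▸ Nat.card_pos.ne'
  obtain ⟨φ, hφ⟩ := exists_equiv_prod_fin ht0 (fun x : G => (x : G ⧸ J)) fun q =>
    (Nat.card_congr ((QuotientAddGroup.preimageMkEquivAddSubgroupProdSet J {q}).trans
      (Equiv.prodUnique _ _))).trans ht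
  have hquotient : Nat.card (G ⧸ J) = r := by
    rw [AddSubgroup.card_eq_card_quotient_mul_card_addSubgroup J, ht] at hr
    exact Nat.eq_of_mul_eq_mul_right (Nat.pos_of_ne_zero ht0) hr
  refine ⟨⟨φ.trans ((Finite.equivFinOfCardEq hquotient).prodCongr (Equiv.refl _)), ?_⟩⟩
  intro x y
  simp only [SimpleGraph.completeEquipartiteGraph_adj, Equiv.trans_apply, Equiv.prodCongr_apply,
    Prod.map_fst, hφ, ne_eq, EmbeddingLike.apply_eq_iff_eq]
  rw [eq_comm, QuotientAddGroup.eq, neg_add_eq_sub]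
  rfl

theorem connected_cosetGraph {a : G} (ha : a ∉ J) : (cosetGraph J).Connected := by
  have : Nonempty G := ⟨a⟩
  have hadj {x y : G} (h : x - y ∉ J) : (cosetGraph J).Reachable x y :=
    SimpleGraph.Adj.reachable (G := cosetGraph J) h
  refine ⟨fun x y => ?_⟩
  by_cases h : x - y ∈ J
  · have hxa : x - (x + a) ∉ J := by rwa [sub_add_cancel_left, J.neg_mem_iff]
    have hay : x + a - y ∉ J := by rwa [add_sub_right_comm, J.add_mem_cancel_left h]
    exact (hadj hxa).trans (hadj hay)
  · exact hadj h

theorem card_sym2_translate_eq {B G : Type*} [Finite B] [AddCommGroup G] (a : B → G) {x y : G}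
    (hxy : x ≠ y) : Nat.card {e : B × G // s(e.2, e.2 + a e.1) = s(x, y)} =
      Nat.card {b // a b = y - x} + Nat.card {b // a b = x - y} := by
  classical
  let directed (x y : G) : {e : B × G // e.2 = x ∧ e.2 + a e.1 = y} ≃ {b // a b = y - x} :=
    { toFun := fun e => ⟨e.1.1, eq_sub_of_add_eq' ((congrArg (· + _) e.2.1).symm.trans e.2.2)⟩
      invFun := fun b => ⟨(b, x), rfl, (congrArg (x + ·) b.2).trans (add_sub_cancel x y)⟩
      left_inv := fun e => Subtype.ext (Prod.ext rfl e.2.1.symm)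
      right_inv := fun _ => rfl }
  have hdisjoint : Disjoint (fun e : B × G => e.2 = x ∧ e.2 + a e.1 = y)
      (fun e => e.2 = y ∧ e.2 + a e.1 = x) :=
    Pi.disjoint_iff.2 fun e => Prop.disjoint_iff.2 fun h => hxy (h.1.1.symm.trans h.2.1)
  rw [← Nat.card_sum]
  exact Nat.card_congr ((Equiv.subtypeEquivRight fun e => Sym2.eq_iff).trans
    ((subtypeOrEquiv _ _ hdisjoint).trans (Equiv.sumCongr (directed x y) (directed y x))))

end CosetGraph

section HeffterArray

/-- The multiset `{±x ∣ x ∈ A}` of the entries of an array and of their negatives. -/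
def PFArray.signedEntries {m n : ℕ} {G : Type} [Neg G] (A : PFArray m n G) : Multiset G :=
  (Finset.univ : Finset A.Skel).val.map A.entry +
    (Finset.univ : Finset A.Skel).val.map (fun b => -A.entry b)

namespace IsHeffterArray

variable {m n v lam t s k : ℕ} {J : AddSubgroup (ZMod v)} {A : PFArray m n (ZMod v)}

theorem card_eq_mul (hA : IsHeffterArray lam t s k J A) :
    v = (2 * n * k / (lam * t) + 1) * t := by
  rw [add_mul, one_mul, ← Nat.div_div_eq_div_mul, Nat.div_mul_cancel hA.t_dvd]
  exact hA.v_eq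

theorem card_skel (hA : IsHeffterArray lam t s k J A) : Fintype.card A.Skel = n * k := by
  rw [Fintype.card_congr (Equiv.sigmaFiberEquiv A.col).symm, Fintype.card_sigma]
  simp only [hA.col_filled, Finset.sum_const, Finset.card_univ, Fintype.card_fin, smul_eq_mul]

theorem card_signedEntries (hA : IsHeffterArray lam t s k J A) :
    Multiset.card A.signedEntries = 2 * n * k := by
  rw [PFArray.signedEntries, Multiset.card_add, Multiset.card_map, Multiset.card_map,
    Finset.card_val, Finset.card_univ, hA.card_skel, mul_assoc, two_mul]

theorem card_notMem [NeZero v] [DecidablePred (· ∈ J)] (hA : IsHeffterArray lam t s k J A) :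
    (Finset.univ.filter (· ∉ J)).card = 2 * n * k / lam := by
  have hJ : (Finset.univ.filter (· ∈ J)).card = t := by
    rw [← hA.card_J, Nat.card_eq_fintype_card, ← Fintype.card_subtype]
  have hsum := Finset.card_filter_add_card_filter_not (s := (Finset.univ : Finset (ZMod v))) (· ∈ J)
  rw [hJ, Finset.card_univ, ZMod.card] at hsum
  have := hA.v_eq
  omega

/-- The entries outside `J` already exhaust the `2nk` elements of `{±x ∣ x ∈ A}`. -/
theorem entry_notMem [NeZero v] (hA : IsHeffterArray lam t s k J A) (b : A.Skel) :
    A.entry b ∉ J := by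
  classical
  have hcard : Multiset.card (A.signedEntries.filter (· ∉ J)) = 2 * n * k := by
    calc Multiset.card (A.signedEntries.filter (· ∉ J))
        = ∑ x : ZMod v, if x ∉ J then A.signedEntries.count x else 0 := by
          rw [← Multiset.sum_count_eq_card fun x _ => Finset.mem_univ x]
          exact Finset.sum_congr rfl fun x _ => Multiset.count_filter
      _ = ∑ _ ∈ Finset.univ.filter (· ∉ J), lam := by
          rw [← Finset.sum_filter]
          exact Finset.sum_congr rfl fun x hx => hA.count_eq x (Finset.mem_filter.1 hx).2
      _ = 2 * n * k := by
          rw [Finset.sum_const, hA.card_notMem, smul_eq_mul, Nat.div_mul_cancel hA.lam_dvd]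
  have hfilter : A.signedEntries.filter (· ∉ J) = A.signedEntries :=
    Multiset.eq_of_le_of_card_le (Multiset.filter_le _ _)
      (hA.card_signedEntries.trans hcard.symm).le
  exact Multiset.filter_eq_self.1 hfilter _
    (Multiset.mem_add.2 (Or.inl (Multiset.mem_map_of_mem _ (Finset.mem_univ b))))

theorem card_entry_eq_add_card_entry_eq_neg (hA : IsHeffterArray lam t s k J A) {x : ZMod v}
    (hx : x ∉ J) :
    Nat.card {b // A.entry b = x} + Nat.card {b // A.entry b = -x} = lam := by
  have hcount (f : A.Skel → ZMod v) (x : ZMod v) :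
      Multiset.count x ((Finset.univ : Finset A.Skel).val.map f) = Nat.card {b // f b = x} := by
    rw [Multiset.count_map, Nat.card_eq_fintype_card, Fintype.card_subtype, Finset.card_def,
      Finset.filter_val]
    simp only [eq_comm]
  rw [← hA.count_eq x hx, Multiset.count_add, hcount, hcount]
  simp only [neg_eq_iff_eq_neg]

theorem card_edge [NeZero v] (hA : IsHeffterArray lam t s k J A) {x y : ZMod v}
    (hxy : x - y ∉ J) :
    Nat.card {e : A.Skel × ZMod v // s(e.2, e.2 + A.entry e.1) = s(x, y)} = lam := by
  have hne : x ≠ y := by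
    rintro rfl
    exact hxy (by rw [sub_self]; exact J.zero_mem)
  rw [card_sym2_translate_eq A.entry hne, add_comm, ← neg_sub x y,
    hA.card_entry_eq_add_card_entry_eq_neg hxy]

variable [Nonempty A.Skel]

theorem two_mul_pos (hA : IsHeffterArray lam t s k J A) : 0 < 2 * n * k := by
  rw [mul_assoc, ← hA.card_skel]
  exact mul_pos two_pos Fintype.card_pos

theorem lam_pos (hA : IsHeffterArray lam t s k J A) : 0 < lam :=
  Nat.pos_of_dvd_of_pos hA.lam_dvd hA.two_mul_pos

theorem modulus_pos (hA : IsHeffterArray lam t s k J A) : 0 < v := by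
  rw [hA.v_eq]
  exact Nat.add_pos_left (Nat.div_pos (Nat.le_of_dvd hA.two_mul_pos hA.lam_dvd) hA.lam_pos) t

end IsHeffterArray

theorem Compatible.isCycleOn {m n : ℕ} {G : Type} {A : PFArray m n G} {ωr : LineOrdering A.row}
    {ωc : LineOrdering A.col} (h : Compatible ωr ωc) : (ωc.perm * ωr.perm).IsCycleOn univ := by
  have hmoved : {x | (ωc.perm * ωr.perm) x ≠ x} = univ := by
    rw [← Equiv.Perm.coe_support_eq_set_support, (Finset.card_eq_iff_eq_univ _).1 h.2,
      Finset.coe_univ]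
  exact hmoved ▸ h.1.isCycleOn

theorem IsHeffterArray.exists_edgeLabelling {m n v lam t s k : ℕ} {J : AddSubgroup (ZMod v)}
    {A : PFArray m n (ZMod v)} [Nonempty A.Skel] [NeZero v] (hA : IsHeffterArray lam t s k J A)
    {ωr : LineOrdering A.row} {ωc : LineOrdering A.col} (hcomp : Compatible ωr ωc) :
    ∃ L : EdgeLabelling (heffterNext ωr ωc A.entry) (cosetGraph J) lam,
      ∀ e, (L.dart e).1.fst = e.2 := by
  have hadj (e : A.Skel × ZMod v) : (cosetGraph J).Adj e.2 (e.2 + A.entry e.1) := by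
    change e.2 - (e.2 + A.entry e.1) ∉ J
    rw [sub_add_cancel_left, J.neg_mem_iff]
    exact hA.entry_notMem e.1
  obtain ⟨φ, hφ⟩ := exists_equiv_prod_fin (X := (cosetGraph J).edgeSet) hA.lam_pos.ne'
    (fun e : A.Skel × ZMod v => ⟨s(e.2, e.2 + A.entry e.1), hadj e⟩) fun ⟨ε, hε⟩ => by
      induction ε using Sym2.ind with
      | _ x y =>
        rw [← hA.card_edge (x := x) (y := y) hε]
        exact Nat.card_congr (Equiv.subtypeEquivRight fun e => Subtype.ext_iff)
  refine ⟨{ dart := fun e => (⟨(e.2, e.2 + A.entry e.1), hadj e⟩, (φ e).2)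
            snd_dart := fun c e => by cases c <;> rfl
            sameCycle := ?_
            exists_fst_dart := fun x => ⟨(Classical.arbitrary _, x), rfl⟩
            existsUnique := fun d => ?_ }, fun _ => rfl⟩
  · rintro ⟨b, x⟩ ⟨b', _⟩ rfl
    let σ := heffterNext ωr ωc A.entry false * (heffterNext ωr ωc A.entry true)⁻¹
    have hstep (b' : A.Skel) :
        σ.SameCycle (b, x) ((ωc.perm * ωr.perm) b', x) = σ.SameCycle (b, x) (b', x) := by
      rw [← heffterNext_vertex_apply, Equiv.Perm.sameCycle_apply_right]
    exact (apply_eq_of_sameCycle (f := fun b' => σ.SameCycle (b, x) (b', x)) hstep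
      (hcomp.isCycleOn.2 (mem_univ b) (mem_univ b'))).mp (.refl σ (b, x))
  · have hedge (e : A.Skel × ZMod v) : (s(e.2, e.2 + A.entry e.1), (φ e).2) = (d.1.edge, d.2) ↔
        φ e = (⟨d.1.edge, d.1.edge_mem⟩, d.2) := by
      rw [Prod.ext_iff, Prod.ext_iff, Subtype.ext_iff, hφ]
    exact (existsUnique_congr hedge).2 (φ.bijective.existsUnique _)

end HeffterArray

end HeffterBiembedding

open HeffterBiembedding in
theorem mainTheorem6 {m n s k lam t v : ℕ} (J : AddSubgroup (ZMod v))
    (A : PFArray m n (ZMod v)) (hA : IsHeffterArray lam t s k J A)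
    (ωr : LineOrdering A.row) (ωc : LineOrdering A.col)
    (hr : ωr.IsSimple A.entry s) (hc : ωc.IsSimple A.entry k) (hcomp : Compatible ωr ωc) :
    Nonempty (cosetGraph J ≃g SimpleGraph.completeEquipartiteGraph (2 * n * k / (lam * t) + 1) t) ∧
    ∃ (D : Fin m × ZMod v → MultiCycle (cosetGraph J) lam s)
      (D' : Fin n × ZMod v → MultiCycle (cosetGraph J) lam k),
      (∀ p, (D p).vertex = ωr.inv.cycleVertices A.entry s p) ∧
      (∀ p, (D' p).vertex = ωc.cycleVertices A.entry k p) ∧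
      ∃ (S : Type) (_ : TopologicalSpace S) (ψ : Realization (cosetGraph J) lam → S),
        IsOrientableSurface S ∧ IsCellular ψ ∧ IsBiembedding ψ D D' := by
  obtain ⟨b, -⟩ := hcomp.1
  have : Nonempty A.Skel := ⟨b⟩
  have : NeZero v := ⟨hA.modulus_pos.ne'⟩
  have : NeZero lam := ⟨hA.lam_pos.ne'⟩
  have hne (b : A.Skel) : A.entry b ≠ 0 := fun h => hA.entry_notMem b (h ▸ J.zero_mem)
  have hrow (ω : LineOrdering A.row) (i) : ω.partialSum A.entry i s = 0 :=
    (ω.partialSum_length A.entry hA.row_filled i).trans (hA.row_sum i)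
  have hcol (i) : ωc.partialSum A.entry i k = 0 :=
    (ωc.partialSum_length A.entry hA.col_filled i).trans (hA.col_sum i)
  obtain ⟨L, hL⟩ := hA.exists_edgeLabelling hcomp
  let T : FaceTracing L true (Fin m × ZMod v) s := ωr.inv.faceTracing hA.row_filled rfl hL
    (hrow ωr.inv) hne (hr.inv hA.row_filled (hrow ωr))
  let T' : FaceTracing L false (Fin n × ZMod v) k := ωc.faceTracing hA.col_filled rfl hL hcol hne hc
  exact ⟨nonempty_cosetGraph_iso J hA.card_J ((Nat.card_zmod v).trans hA.card_eq_mul),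
    T.cycle, T'.cycle, fun p => funext fun j => hL _, fun p => funext fun j => hL _,
    MapSurface (heffterNext ωr ωc A.entry), inferInstance, L.embed,
    isOrientableSurface fun _ => L.eq_univ_of_rotation_mem_iff
      (connected_cosetGraph J (hA.entry_notMem b)),
    L.isCellular_embed, T.isBiembedding T'⟩
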